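/- Consider batteries made of $n$ two-level cells, each with Hamiltonian $\hat h=|1\rangle\langle 1|$, total Hamiltonian $\hat H^{(n)}=\sum_{i=1}^n\hat h_i$, and mean energy $\mathfrak E(\rho)=\mathrm{Tr}[\rho \hat H^{(n)}]$. The ergotropy of a state $\rho$ of the $n$ cells is $\mathcal E(\rho)=\max_U\{\mathfrak E(\rho)-\mathfrak E(U\rho U^\dagger)\}$ over all unitaries $U$, and the local ergotropy $\mathcal E_{\rm loc}(\rho)$ is the same maximum over the product unitaries $U=U_1\otimes\cdots\otimes U_n$. For a single-cell channel $\Lambda$ let $\mathcal E^{(n)}(\Lambda;E)=\max_\rho \mathcal E(\Lambda^{\otimes n}(\rho))$ over the density matrices $\rho$ of $n$ cells with $\mathfrak E(\rho)\le E$, and $$\mathcal J_{\mathcal E}(\Lambda)=\limsup_{E\to\infty}\ \sup_{n\ge\lceil E\rceil}\frac{\mathcal E^{(n)}(\Lambda;E)}{E}\in[-\infty,\infty].$$ The separable-input, local, and separable-input local maximal asymptotic work/energy ratios (MAWERs) $\mathcal J_{\rm sep}(\Lambda)$, $\mathcal J_{\rm loc}(\Lambda)$, $\mathcal J_{\rm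 loc,sep}(\Lambda)$ are defined in the same way with, respectively, $\rho$ restricted to (fully) separable states, $\mathcal E$ replaced by $\mathcal E_{\rm loc}$, and both. Let $\gamma\in[0,1]$ and $\eta\in[0,1/2]$ with $(\gamma,\eta)\ne(1,1/2)$. Let $$\Phi_{\gamma,\eta}(\rho)=\begin{pmatrix}1-\gamma\eta-(1-\gamma)\rho_{11}&\sqrt{1-\gamma}\,\rho_{01}\\ \sqrt{1-\gamma}\,\rho_{10}&\gamma\eta+(1-\gamma)\rho_{11}\end{pmatrix}$$ be the generalized amplitude damping channel (on density matrices, extended linearly), and $$\Phi_\gamma(\rho)=\begin{pmatrix}\rho_{00}+\gamma\rho_{11}&\sqrt{1-\gamma}\,\rho_{01}\\ \sqrt{1-\gamma}\,\rho_{10}&(1-\gamma)\rho_{11}\end{pmatrix}$$ the amplitude damping channel. Then: 1. $\displaystyle \mathcal J_{\rm sep}(\Phi_{\gamma,\eta})=\mathcal J_{\rm loc}(\Phi_{\gamma,\eta})=\mathcal J_{\rm loc,sep}(\Phi_{\gamma,\eta})=\frac{1-\gamma}{1-2\eta\gamma}.$ 2. This value is attained by coherent product inputs. For $E>0$ and $n\ge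 E$ let $\rho_{n,E}=(|\psi_{E/n}\rangle\langle\psi_{E/n}|)^{\otimes n}$ with $|\psi_{e}\rangle=\sqrt{1-e}\,|0\rangle+\sqrt e\,|1\rangle$; this is a separable state of mean energy exactly $E$. For every $E>0$, $$\lim_{n\to\infty}\frac{\mathcal E(\Phi_{\gamma,\eta}^{\otimes n}(\rho_{n,E}))}{E}=\lim_{n\to\infty}\frac{\mathcal E_{\rm loc}(\Phi_{\gamma,\eta}^{\otimes n}(\rho_{n,E}))}{E}=\frac{1-\gamma}{1-2\eta\gamma}.$$ More precisely there is a constant $C$ depending only on $\gamma,\eta$ such that for all $E>0$ and all integers $n\ge E$ both ratios differ from $\frac{1-\gamma}{1-2\eta\gamma}$ by at most $C\,E/n$. 3. $\mathcal J_{\mathcal E}(\Phi_\gamma)=1-\gamma$, and if $\eta>0$ and $0<\gamma<1$, then each of $\mathcal J_{\rm sep}(\Phi_{\gamma,\eta})$, $\mathcal J_{\rm loc}(\Phi_{\gamma,\eta})$, $\mathcal J_{\rm loc,sep}(\Phi_{\gamma,\eta})$ is strictly larger than $\mathcal J_{\mathcal E}(\Phi_\gamma)$. 4. If $\eta=1/2$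 (hence $\gamma<1$), then $\mathcal J_{\rm sep}(\Phi_{\gamma,\eta})=\mathcal J_{\rm loc}(\Phi_{\gamma,\eta})=\mathcal J_{\rm loc,sep}(\Phi_{\gamma,\eta})=1$. -/

import Mathlib

open Filter Topology
open scoped ComplexOrder

namespace QuantumBattery

noncomputable section

/-- Operators on a single two-level q-cell, in the energy basis `|0⟩, |1⟩`. -/
abbrev QubitOp : Type := Matrix (Fin 2) (Fin 2) ℂ

/-- Operators on `n` two-level q-cells, in the product basis `|a₁⟩ ⊗ ⋯ ⊗ |aₙ⟩`. -/
abbrev CellsOp (n : ℕ) : Type := Matrix (Fin n → Fin 2) (Fin n → Fin 2) ℂ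

/-- The tensor product `A₁ ⊗ ⋯ ⊗ Aₙ` of single-cell operators. -/
def tensor {n : ℕ} (A : Fin n → QubitOp) : CellsOp n :=
  Matrix.of fun a b => ∏ i, A i (a i) (b i)

/-- Density matrices: positive semidefinite with unit trace. -/
def IsDensity {ι : Type*} [Fintype ι] (ρ : Matrix ι ι ℂ) : Prop :=
  ρ.PosSemidef ∧ ρ.trace = 1

/-- (Fully) separable states of the `n` cells: convex combinations of product states. -/
def IsSeparable {n : ℕ} (ρ : CellsOp n) : Prop :=
  ρ ∈ convexHull ℝ {τ : CellsOp n | ∃ σ : Fin n → QubitOp, (∀ i, IsDensity (σ i)) ∧ τ = tensor σ}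

/-- The single-cell Hamiltonian `|1⟩⟨1|` (ground energy `0`, maximal eigenvalue `1`). -/
def cellHamiltonian : QubitOp := !![0, 0; 0, 1]

/-- The battery Hamiltonian `∑ᵢ 1 ⊗ ⋯ ⊗ |1⟩⟨1| ⊗ ⋯ ⊗ 1`, with `|1⟩⟨1|` on the `i`-th cell. -/
def hamiltonian (n : ℕ) : CellsOp n :=
  ∑ i, tensor (Function.update (fun _ => (1 : QubitOp)) i cellHamiltonian)

/-- The mean energy `Tr[ρ H]` of a state of `n` cells. -/
def energy {n : ℕ} (ρ : CellsOp n) : ℝ := (ρ * hamiltonian n).trace.re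

/-- All unitary operators on the `n` cells. -/
def globalUnitaries (n : ℕ) : Set (CellsOp n) :=
  {U | U ∈ Matrix.unitaryGroup (Fin n → Fin 2) ℂ}

/-- The local unitary operators `U₁ ⊗ ⋯ ⊗ Uₙ`. -/
def localUnitaries (n : ℕ) : Set (CellsOp n) :=
  {U | ∃ V : Fin n → QubitOp, (∀ i, V i ∈ Matrix.unitaryGroup (Fin 2) ℂ) ∧ U = tensor V}

/-- The maximal energy decrease of the state `ρ` under the operations `ρ ↦ U ρ U†`, `U ∈ 𝒰`. -/
def extractableWork {n : ℕ} (𝒰 : Set (CellsOp n)) (ρ : CellsOp n) : ℝ :=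
  ⨆ U : 𝒰, (energy ρ - energy (U.1 * ρ * U.1.conjTranspose))

/-- Local unitaries are unitary. -/
theorem localUnitaries_subset (n : ℕ) : localUnitaries n ⊆ globalUnitaries n := by
  rintro U ⟨V, hV, rfl⟩
  rw [globalUnitaries, Set.mem_ofPred_eq, Matrix.mem_unitaryGroup_iff]
  ext a b
  have h : ∀ i, ∑ c, V i (a i) c * star (V i (b i) c) = (1 : QubitOp) (a i) (b i) := fun i => by
    have := congrFun (congrFun (Matrix.mem_unitaryGroup_iff.1 (hV i)) (a i)) (b i)
    simpa [Matrix.mul_apply, Matrix.star_apply] using this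
  simp only [Matrix.mul_apply, Matrix.star_apply, tensor, Matrix.of_apply, star_prod,
    ← Finset.prod_mul_distrib]
  rw [← Fintype.prod_sum (fun i c => V i (a i) c * star (V i (b i) c))]
  simp only [h, Matrix.one_apply]
  by_cases hab : a = b
  · simp [hab]
  · obtain ⟨i, hi⟩ := Function.ne_iff.1 hab
    rw [if_neg hab]
    exact Finset.prod_eq_zero (Finset.mem_univ i) (if_neg hi)

/-- The supremum defining the extractable work is taken over a bounded set of reals. -/
theorem bddAbove_work {n : ℕ} {𝒰 : Set (CellsOp n)} (h𝒰 : 𝒰 ⊆ globalUnitaries n)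
    (ρ : CellsOp n) :
    BddAbove (Set.range fun U : 𝒰 => energy ρ - energy (U.1 * ρ * U.1.conjTranspose)) := by
  refine ⟨energy ρ + ∑ a, ∑ b, ∑ c, ∑ d, ‖ρ d c‖ * ‖hamiltonian n b a‖, ?_⟩
  rintro _ ⟨U, rfl⟩
  have hU : ∀ x y, ‖U.1 x y‖ ≤ 1 := entry_norm_bound_of_unitary (h𝒰 U.2)
  have key : ‖(U.1 * ρ * U.1.conjTranspose * hamiltonian n).trace‖
      ≤ ∑ a, ∑ b, ∑ c, ∑ d, ‖ρ d c‖ * ‖hamiltonian n b a‖ := by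
    simp only [Matrix.trace, Matrix.diag, Matrix.mul_apply, Finset.sum_mul]
    refine (norm_sum_le _ _).trans (Finset.sum_le_sum fun a _ => ?_)
    refine (norm_sum_le _ _).trans (Finset.sum_le_sum fun b _ => ?_)
    refine (norm_sum_le _ _).trans (Finset.sum_le_sum fun c _ => ?_)
    refine (norm_sum_le _ _).trans (Finset.sum_le_sum fun d _ => ?_)
    simp only [norm_mul, Matrix.conjTranspose_apply, norm_star]
    have h1 := hU a d
    have h2 := hU b c
    calc ‖U.1 a d‖ * ‖ρ d c‖ * ‖U.1 b c‖ * ‖hamiltonian n b a‖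
        ≤ 1 * ‖ρ d c‖ * 1 * ‖hamiltonian n b a‖ := by gcongr
      _ = _ := by ring
  have := (abs_le.1 ((Complex.abs_re_le_norm _).trans key)).1
  simp only [energy]
  linarith

/-- The ergotropy of a state of `n` cells. -/
def ergotropy {n : ℕ} (ρ : CellsOp n) : ℝ := extractableWork (globalUnitaries n) ρ

/-- The local ergotropy of a state of `n` cells. -/
def localErgotropy {n : ℕ} (ρ : CellsOp n) : ℝ := extractableWork (localUnitaries n) ρ

/-- The tensor power `Λ^{⊗n}` of a linear map on single-cell operators, given by linear extension
from the matrix units `|c₁⟩⟨d₁| ⊗ ⋯ ⊗ |cₙ⟩⟨dₙ|`. -/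
def channelPower (Λ : QubitOp →ₗ[ℂ] QubitOp) (n : ℕ) (ρ : CellsOp n) : CellsOp n :=
  ∑ c : Fin n → Fin 2, ∑ d : Fin n → Fin 2,
    ρ c d • tensor fun i => Λ (Matrix.single (c i) (d i) 1)

/-- `Λ^{⊗n}(A₁ ⊗ ⋯ ⊗ Aₙ) = Λ(A₁) ⊗ ⋯ ⊗ Λ(Aₙ)`. -/
theorem channelPower_tensor (Λ : QubitOp →ₗ[ℂ] QubitOp) (n : ℕ) (A : Fin n → QubitOp) :
    channelPower Λ n (tensor A) = tensor fun i => Λ (A i) := by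
  have key : ∀ (B : QubitOp) (x y : Fin 2), Λ B x y
      = ∑ p : Fin 2 × Fin 2, B p.1 p.2 * Λ (Matrix.single p.1 p.2 1) x y := by
    intro B x y
    conv_lhs => rw [Matrix.matrix_eq_sum_single B]
    simp only [map_sum, Matrix.sum_apply, Fintype.sum_prod_type]
    refine Finset.sum_congr rfl fun p _ => Finset.sum_congr rfl fun q _ => ?_
    have : Matrix.single p q (B p q) = B p q • Matrix.single p q (1 : ℂ) := by
      simp [Matrix.smul_single]
    rw [this, map_smul]
    rfl
  ext a b
  simp only [channelPower, tensor, Matrix.sum_apply, Matrix.smul_apply, Matrix.of_apply,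
    smul_eq_mul]
  simp_rw [key (A _), Fintype.prod_sum, Finset.prod_mul_distrib]
  rw [← Fintype.sum_prod_type']
  exact Fintype.sum_equiv (Equiv.arrowProdEquivProdArrow (Fin n) (fun _ => Fin 2)
    (fun _ => Fin 2)).symm _ _ fun _ => rfl

/-- The density matrices of `n` cells whose mean energy is at most `E`. -/
def states (n : ℕ) (E : ℝ) : Set (CellsOp n) := {ρ | IsDensity ρ ∧ energy ρ ≤ E}

/-- The separable density matrices of `n` cells whose mean energy is at most `E`. -/
def separableStates (n : ℕ) (E : ℝ) : Set (CellsOp n) := {ρ ∈ states n E | IsSeparable ρ}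

/-- The maximal asymptotic work/energy ratio for input states `S n E` of `n` cells with energy at
most `E` and figure of merit `W n` of the output:
`limsup_{E → ∞} sup_{n ≥ ⌈E⌉} (max_{ρ ∈ S n E} W n (Λ^{⊗n}(ρ))) / E`, an extended real number. -/
def mawer (S : (n : ℕ) → ℝ → Set (CellsOp n)) (W : (n : ℕ) → CellsOp n → ℝ)
    (Λ : QubitOp →ₗ[ℂ] QubitOp) : EReal :=
  limsup (fun E : ℝ => ⨆ n : ℕ, ⨆ _ : ⌈E⌉₊ ≤ n,
    (⨆ ρ ∈ S n E, ((W n (channelPower Λ n ρ) : ℝ) : EReal)) / (E : EReal)) atTop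

/-- The unrestricted (ergotropic) MAWER. -/
def ergotropicMawer (Λ : QubitOp →ₗ[ℂ] QubitOp) : EReal :=
  mawer states (fun _ => ergotropy) Λ

/-- The separable-input MAWER. -/
def sepMawer (Λ : QubitOp →ₗ[ℂ] QubitOp) : EReal :=
  mawer separableStates (fun _ => ergotropy) Λ

/-- The local MAWER. -/
def locMawer (Λ : QubitOp →ₗ[ℂ] QubitOp) : EReal :=
  mawer states (fun _ => localErgotropy) Λ

/-- The separable-input local MAWER. -/
def locSepMawer (Λ : QubitOp →ₗ[ℂ] QubitOp) : EReal :=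
  mawer separableStates (fun _ => localErgotropy) Λ

/-- The amplitude damping channel `Φ_γ`. -/
def adc (γ : ℝ) : QubitOp →ₗ[ℂ] QubitOp where
  toFun ρ :=
    !![ρ 0 0 + (γ : ℂ) * ρ 1 1, (√(1 - γ) : ℂ) * ρ 0 1;
       (√(1 - γ) : ℂ) * ρ 1 0, (1 - γ : ℂ) * ρ 1 1]
  map_add' ρ σ := by
    ext i j; fin_cases i <;> fin_cases j <;> simp <;> ring
  map_smul' c ρ := by
    ext i j; fin_cases i <;> fin_cases j <;> simp <;> ring

/-- The generalized amplitude damping channel `Φ_{γ,η}`, extended linearly from the density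
matrices (for which `ρ.trace = 1`) to all matrices. -/
def gadc (γ η : ℝ) : QubitOp →ₗ[ℂ] QubitOp where
  toFun ρ :=
    !![(1 - γ * η : ℂ) * ρ.trace - (1 - γ : ℂ) * ρ 1 1, (√(1 - γ) : ℂ) * ρ 0 1;
       (√(1 - γ) : ℂ) * ρ 1 0, (γ * η : ℂ) * ρ.trace + (1 - γ : ℂ) * ρ 1 1]
  map_add' ρ σ := by
    ext i j; fin_cases i <;> fin_cases j <;> simp [Matrix.trace_fin_two] <;> ring
  map_smul' c ρ := by
    ext i j; fin_cases i <;> fin_cases j <;> simp [Matrix.trace_fin_two] <;> ring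

/-- The density matrix of the coherent pure state `√(1 - e) |0⟩ + √e |1⟩`, `e ∈ [0, 1]`. -/
def coherentState (e : ℝ) : QubitOp :=
  Matrix.vecMulVec ![(√(1 - e) : ℂ), (√e : ℂ)] (star ![(√(1 - e) : ℂ), (√e : ℂ)])

/-- The product of `n` copies of the coherent state of energy `E / n`, of total energy `E`. -/
def coherentInput (n : ℕ) (E : ℝ) : CellsOp n := tensor fun _ => coherentState (E / n)

end

end QuantumBattery

open QuantumBattery

/-!
Every cell of a state of `n` cells damped by `Φ_{γ,η}` has population `γη + (1 - γ)e`, where `e` is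
the population of the input cell, and a coherence of squared modulus at most `(1 - γ)e(1 - e)`. Put
`X = 1 - 2ηγ` and `c = (1 - γ) / X`.

Local unitaries act on the one-cell marginals, and there the coherent work is at most `c e` by
AM-GM. For separable inputs and global unitaries linearity reduces to products, for which the
Gibbs variational principle for a product of thermal states at inverse temperature
`β = log ((1 - γη) / (γη)) = 2 artanh X` bounds the final energy below by the output entropy. What
remains is a one-cell inequality between the entropy and the energy of the output. The output
entropy is smallest for pure inputs, and along these the entropy plus the linear term
`2 β η γ c e` is monotone in `e`, because `√(1 - L²) artanh L / L` decreases in `L`.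

Conversely, rotating each cell by the angle of tangent `√((1 - γ)e) / X` extracts `c e (1 - O(e))`
from the coherent state of energy `e = E / n`.
-/

namespace QuantumBattery

open Matrix

section Tensor

variable {n : ℕ}

theorem tensor_mul (A B : Fin n → QubitOp) : tensor A * tensor B = tensor fun i => A i * B i := by
  ext a b
  simp only [tensor, mul_apply, of_apply, ← Finset.prod_mul_distrib]
  rw [← Fintype.prod_sum (fun i c => A i (a i) c * B i c (b i))]

theorem conjTranspose_tensor (A : Fin n → QubitOp) : (tensor A)ᴴ = tensor fun i => (A i)ᴴ := by
  ext a b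
  simp [tensor]

theorem trace_tensor (A : Fin n → QubitOp) : (tensor A).trace = ∏ i, (A i).trace := by
  simp only [trace, tensor, diag_apply, of_apply]
  rw [← Fintype.prod_sum (fun i c => A i c c)]

theorem tensor_diagonal (d : Fin n → Fin 2 → ℂ) :
    tensor (fun i => diagonal (d i)) = diagonal fun a => ∏ i, d i (a i) := by
  ext a b
  simp [tensor, diagonal_apply, Finset.prod_ite_zero, funext_iff]

theorem tensor_single (c d : Fin n → Fin 2) :
    tensor (fun i => single (c i) (d i) (1 : ℂ)) = single c d 1 := by
  ext a b
  simp [tensor, single_apply, Finset.prod_ite_zero, funext_iff, forall_and]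

theorem linearMap_ext_tensor {M : Type*} [AddCommMonoid M] [Module ℂ M] {f g : CellsOp n →ₗ[ℂ] M}
    (h : ∀ A, f (tensor A) = g (tensor A)) : f = g :=
  ext_linearMap ℂ fun c d => LinearMap.ext_ring <| by
    simpa [tensor_single] using h fun i => single (c i) (d i) 1

end Tensor

section Marginal

variable {n : ℕ}

/-- The state of the `i`-th cell: the partial trace of an operator over all the other cells. -/
noncomputable def marginal (i : Fin n) : CellsOp n →ₗ[ℂ] QubitOp where
  toFun ρ := ∑ r : {j // j ≠ i} → Fin 2,
    ρ.submatrix (fun k => (Equiv.funSplitAt i (Fin 2)).symm (k, r))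
      (fun k => (Equiv.funSplitAt i (Fin 2)).symm (k, r))
  map_add' ρ σ := by simp [submatrix_add, Finset.sum_add_distrib]
  map_smul' c ρ := by simp [submatrix_smul, Finset.smul_sum]

theorem marginal_apply (i : Fin n) (ρ : CellsOp n) (a b : Fin 2) :
    marginal i ρ a b = ∑ r : {j // j ≠ i} → Fin 2,
      ρ ((Equiv.funSplitAt i (Fin 2)).symm (a, r)) ((Equiv.funSplitAt i (Fin 2)).symm (b, r)) := by
  simp [marginal, Matrix.sum_apply]

theorem posSemidef_marginal (i : Fin n) {ρ : CellsOp n} (hρ : ρ.PosSemidef) :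
    (marginal i ρ).PosSemidef :=
  posSemidef_sum _ fun _ _ => hρ.submatrix _

theorem sum_diag_mul_apply (ρ : CellsOp n) (i : Fin n) (f : Fin 2 → ℝ) :
    ∑ s, (ρ s s).re * f (s i) = ∑ a, (marginal i ρ a a).re * f a := by
  rw [← (Equiv.funSplitAt i (Fin 2)).symm.sum_comp, Fintype.sum_prod_type]
  simp [marginal_apply, Finset.sum_mul]

theorem trace_marginal (i : Fin n) (ρ : CellsOp n) : (marginal i ρ).trace = ρ.trace := by
  rw [trace, trace, ← (Equiv.funSplitAt i (Fin 2)).symm.sum_comp, Fintype.sum_prod_type]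
  simp [marginal_apply]

theorem marginal_tensor (i : Fin n) (A : Fin n → QubitOp) :
    marginal i (tensor A) = (∏ j : {j // j ≠ i}, (A j).trace) • A i := by
  ext a b
  have hsplit (r : {j // j ≠ i} → Fin 2) :
      tensor A ((Equiv.funSplitAt i (Fin 2)).symm (a, r)) ((Equiv.funSplitAt i (Fin 2)).symm (b, r))
        = A i a b * ∏ j : {j // j ≠ i}, A j (r j) (r j) := by
    simp only [tensor, of_apply]
    rw [Fintype.prod_eq_mul_prod_subtype_ne _ i]
    congr 1
    · simp
    · exact Finset.prod_congr rfl fun j _ => by simp [j.2]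
  rw [marginal_apply, Finset.sum_congr rfl fun r _ => hsplit r, ← Finset.mul_sum,
    ← Fintype.prod_sum fun (j : {j // j ≠ i}) k => A j k k]
  simp [trace, mul_comm]

theorem trace_unitary_conj {ι : Type*} [Fintype ι] [DecidableEq ι] {U : Matrix ι ι ℂ}
    (hU : U ∈ unitaryGroup ι ℂ) (A : Matrix ι ι ℂ) : (U * A * Uᴴ).trace = A.trace := by
  rw [trace_mul_comm, ← mul_assoc, ← star_eq_conjTranspose, mem_unitaryGroup_iff'.1 hU, one_mul]

theorem marginal_tensor_conj {V : Fin n → QubitOp} (hV : ∀ i, V i ∈ unitaryGroup (Fin 2) ℂ)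
    (i : Fin n) (ρ : CellsOp n) :
    marginal i (tensor V * ρ * (tensor V)ᴴ) = V i * marginal i ρ * (V i)ᴴ := by
  suffices marginal i ∘ₗ LinearMap.mulLeftRight ℂ (tensor V, (tensor V)ᴴ)
      = LinearMap.mulLeftRight ℂ (V i, (V i)ᴴ) ∘ₗ marginal i by
    simpa using LinearMap.congr_fun this ρ
  refine linearMap_ext_tensor fun A => ?_
  simp [conjTranspose_tensor, tensor_mul, marginal_tensor, trace_unitary_conj (hV _)]

theorem trace_mul_hamiltonian (ρ : CellsOp n) :
    (ρ * hamiltonian n).trace = ∑ i, marginal i ρ 1 1 := by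
  suffices traceLinearMap _ ℂ ℂ ∘ₗ LinearMap.mulRight ℂ (hamiltonian n)
      = ∑ i, entryLinearMap ℂ ℂ 1 1 ∘ₗ marginal i by
    simpa using LinearMap.congr_fun this ρ
  refine linearMap_ext_tensor fun A => ?_
  simp only [hamiltonian, LinearMap.comp_apply, LinearMap.mulRight_apply, Finset.mul_sum, map_sum,
    LinearMap.sum_apply, traceLinearMap_apply, tensor_mul, trace_tensor, marginal_tensor]
  refine Finset.sum_congr rfl fun i _ => ?_
  have hne (j : {j // j ≠ i}) : Function.update (fun _ => (1 : QubitOp)) i cellHamiltonian j = 1 :=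
    Function.update_of_ne j.2 _ _
  have hexcited : (A i * cellHamiltonian).trace = A i 1 1 := by
    simp [cellHamiltonian, trace_fin_two, mul_apply]
  simp only [Fintype.prod_eq_mul_prod_subtype_ne _ i, Function.update_self, hne, mul_one, hexcited]
  simp [mul_comm]

theorem energy_eq_sum_marginal (ρ : CellsOp n) : energy ρ = ∑ i, (marginal i ρ 1 1).re := by
  rw [energy, trace_mul_hamiltonian, Complex.re_sum]

theorem energy_nonneg {ρ : CellsOp n} (hρ : ρ.PosSemidef) : 0 ≤ energy ρ := by
  rw [energy_eq_sum_marginal]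
  exact Finset.sum_nonneg fun i _ =>
    (Complex.nonneg_iff.1 ((posSemidef_marginal i hρ).diag_nonneg (i := 1))).1

theorem energy_tensor {A : Fin n → QubitOp} (hA : ∀ i, (A i).trace = 1) :
    energy (tensor A) = ∑ i, (A i 1 1).re := by
  simp [energy_eq_sum_marginal, marginal_tensor, hA]

end Marginal

section ChannelPower

variable {n : ℕ} {Λ : QubitOp →ₗ[ℂ] QubitOp}

/-- The tensor power `Λ^{⊗n}` of `channelPower`, bundled as a linear map. -/
noncomputable def channelPowerLin (Λ : QubitOp →ₗ[ℂ] QubitOp) (n : ℕ) :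
    CellsOp n →ₗ[ℂ] CellsOp n where
  toFun := channelPower Λ n
  map_add' ρ σ := by simp [channelPower, add_smul, Finset.sum_add_distrib]
  map_smul' z ρ := by simp [channelPower, Finset.smul_sum, mul_smul]

@[simp]
theorem channelPowerLin_apply (ρ : CellsOp n) : channelPowerLin Λ n ρ = channelPower Λ n ρ := rfl

theorem marginal_channelPower (hΛ : ∀ A, (Λ A).trace = A.trace) (i : Fin n) (ρ : CellsOp n) :
    marginal i (channelPower Λ n ρ) = Λ (marginal i ρ) := by
  suffices marginal i ∘ₗ channelPowerLin Λ n = Λ ∘ₗ marginal i from LinearMap.congr_fun this ρ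
  refine linearMap_ext_tensor fun A => ?_
  simp [channelPower_tensor, marginal_tensor, hΛ]

theorem tensor_sum {κ : Type*} [Fintype κ] (A : Fin n → κ → QubitOp) :
    tensor (fun i => ∑ k, A i k) = ∑ k : Fin n → κ, tensor fun i => A i (k i) := by
  ext a b
  simp only [tensor, of_apply, Matrix.sum_apply]
  rw [Fintype.prod_sum]

theorem channelPower_eq_sum_kraus {κ : Type*} [Fintype κ] {K : κ → QubitOp}
    (hK : ∀ A, Λ A = ∑ k, K k * A * (K k)ᴴ) (ρ : CellsOp n) :
    channelPower Λ n ρ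
      = ∑ k : Fin n → κ, tensor (fun i => K (k i)) * ρ * (tensor fun i => K (k i))ᴴ := by
  suffices channelPowerLin Λ n = ∑ k : Fin n → κ, LinearMap.mulLeftRight ℂ
      (tensor (fun i => K (k i)), (tensor fun i => K (k i))ᴴ) by
    simpa using LinearMap.congr_fun this ρ
  refine linearMap_ext_tensor fun A => ?_
  simp [channelPower_tensor, hK, tensor_sum, tensor_mul, conjTranspose_tensor]

theorem posSemidef_channelPower_of_kraus {κ : Type*} [Fintype κ] {K : κ → QubitOp}
    (hK : ∀ A, Λ A = ∑ k, K k * A * (K k)ᴴ) {ρ : CellsOp n} (hρ : ρ.PosSemidef) :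
    (channelPower Λ n ρ).PosSemidef := by
  rw [channelPower_eq_sum_kraus hK]
  exact posSemidef_sum _ fun _ _ => hρ.mul_mul_conjTranspose_same _

end ChannelPower

section QubitDensity

namespace IsDensity

variable {σ : QubitOp}

theorem re_apply_zero_zero (hσ : IsDensity σ) : (σ 0 0).re = 1 - (σ 1 1).re := by
  have h := congrArg Complex.re hσ.2
  rw [trace_fin_two, Complex.add_re, Complex.one_re] at h
  linarith

theorem re_apply_one_one_nonneg (hσ : IsDensity σ) : 0 ≤ (σ 1 1).re :=
  (Complex.nonneg_iff.1 (hσ.1.diag_nonneg (i := 1))).1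

theorem re_apply_one_one_le_one (hσ : IsDensity σ) : (σ 1 1).re ≤ 1 := by
  have h := (Complex.nonneg_iff.1 (hσ.1.diag_nonneg (i := 0))).1
  rw [hσ.re_apply_zero_zero] at h
  linarith

theorem re_det (hσ : IsDensity σ) :
    σ.det.re = (σ 1 1).re * (1 - (σ 1 1).re) - ‖σ 0 1‖ ^ 2 := by
  have him := (Complex.nonneg_iff.1 (hσ.1.diag_nonneg (i := 1))).2
  rw [det_fin_two, ← hσ.1.1.apply 1 0, RCLike.star_def, Complex.mul_conj, Complex.sub_re,
    Complex.mul_re, ← him, Complex.ofReal_re, Complex.normSq_eq_norm_sq, hσ.re_apply_zero_zero]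
  ring

theorem norm_sq_apply_zero_one_le (hσ : IsDensity σ) :
    ‖σ 0 1‖ ^ 2 ≤ (σ 1 1).re * (1 - (σ 1 1).re) := by
  have hdet := (Complex.nonneg_iff.1 hσ.1.det_nonneg).1
  rw [hσ.re_det] at hdet
  linarith

theorem marginal {n : ℕ} {ρ : CellsOp n} (hρ : IsDensity ρ) (i : Fin n) :
    IsDensity (marginal i ρ) :=
  ⟨posSemidef_marginal i hρ.1, by rw [trace_marginal, hρ.2]⟩

end IsDensity

end QubitDensity

section Damping

variable {γ η : ℝ}

theorem trace_adc (γ : ℝ) (A : QubitOp) : (adc γ A).trace = A.trace := by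
  simp [adc, trace_fin_two]
  ring

theorem trace_gadc (γ η : ℝ) (A : QubitOp) : (gadc γ η A).trace = A.trace := by
  simp [gadc, trace_fin_two]
  ring

theorem gadc_eq_adc (h : γ * η = 0) : gadc γ η = adc γ := by
  have h' : (γ : ℂ) * η = 0 := by exact_mod_cast h
  ext A i j
  fin_cases i <;> fin_cases j <;> simp [gadc, adc, h', trace_fin_two]
  ring

/-- The Kraus operators of the amplitude damping channel: no decay, and decay of the cell. -/
noncomputable def adcKraus (γ : ℝ) : Fin 2 → QubitOp :=
  ![!![1, 0; 0, (√(1 - γ) : ℂ)], !![0, (√γ : ℂ); 0, 0]]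

theorem adc_eq_sum_kraus (hγ₀ : 0 ≤ γ) (hγ₁ : γ ≤ 1) (A : QubitOp) :
    adc γ A = ∑ k, adcKraus γ k * A * (adcKraus γ k)ᴴ := by
  have hdecay : (√γ : ℂ) * √γ = γ := by
    rw [← Complex.ofReal_mul, Real.mul_self_sqrt hγ₀]
  have hkeep : (√(1 - γ) : ℂ) * √(1 - γ) = 1 - γ := by
    rw [← Complex.ofReal_mul, Real.mul_self_sqrt (sub_nonneg.2 hγ₁), Complex.ofReal_sub,
      Complex.ofReal_one]
  ext i j
  simp only [Matrix.sum_apply, mul_apply, Fin.sum_univ_two, conjTranspose_apply]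
  fin_cases i <;> fin_cases j <;> simp [adc, adcKraus]
  · linear_combination -A 1 1 * hdecay
  · ring
  · linear_combination -A 1 1 * hkeep

theorem posSemidef_adc (hγ₀ : 0 ≤ γ) (hγ₁ : γ ≤ 1) {A : QubitOp} (hA : A.PosSemidef) :
    (adc γ A).PosSemidef := by
  rw [adc_eq_sum_kraus hγ₀ hγ₁]
  exact posSemidef_sum _ fun _ _ => hA.mul_mul_conjTranspose_same _

theorem gadc_eq_mixture (γ η : ℝ) (A : QubitOp) :
    gadc γ η A = (1 - η) • adc γ A
      + η • (adc γ (A.submatrix Fin.rev Fin.rev)).submatrix Fin.rev Fin.rev := by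
  ext i j
  fin_cases i <;> fin_cases j <;> simp [gadc, adc, trace_fin_two] <;> ring

theorem isDensity_gadc (hγ₀ : 0 ≤ γ) (hγ₁ : γ ≤ 1) (hη₀ : 0 ≤ η) (hη₁ : η ≤ 1) {σ : QubitOp}
    (hσ : IsDensity σ) : IsDensity (gadc γ η σ) := by
  refine ⟨?_, by rw [trace_gadc, hσ.2]⟩
  rw [gadc_eq_mixture]
  exact ((posSemidef_adc hγ₀ hγ₁ hσ.1).smul (sub_nonneg.2 hη₁)).add
    (((posSemidef_adc hγ₀ hγ₁ (hσ.1.submatrix _)).submatrix _).smul hη₀)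

theorem re_gadc_apply_one_one (γ η : ℝ) {σ : QubitOp} (hσ : σ.trace = 1) :
    (gadc γ η σ 1 1).re = γ * η + (1 - γ) * (σ 1 1).re := by
  simp [gadc, hσ]

theorem norm_sq_gadc_apply_zero_one (hγ₁ : γ ≤ 1) (η : ℝ) (σ : QubitOp) :
    ‖gadc γ η σ 0 1‖ ^ 2 = (1 - γ) * ‖σ 0 1‖ ^ 2 := by
  simp [gadc, mul_pow, Real.sq_sqrt (sub_nonneg.2 hγ₁)]

end Damping

section ExtractableWork

variable {n : ℕ}

theorem localUnitaries_nonempty (n : ℕ) : (localUnitaries n).Nonempty :=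
  ⟨_, fun _ => 1, fun _ => one_mem _, rfl⟩

theorem globalUnitaries_nonempty (n : ℕ) : (globalUnitaries n).Nonempty :=
  (localUnitaries_nonempty n).mono (localUnitaries_subset n)

theorem extractableWork_le {𝒰 : Set (CellsOp n)} (h𝒰 : 𝒰.Nonempty) {ρ : CellsOp n} {w : ℝ}
    (h : ∀ U ∈ 𝒰, energy ρ - energy (U * ρ * Uᴴ) ≤ w) : extractableWork 𝒰 ρ ≤ w :=
  have := h𝒰.to_subtype
  ciSup_le fun U => h U.1 U.2

theorem le_extractableWork {𝒰 : Set (CellsOp n)} (h𝒰 : 𝒰 ⊆ globalUnitaries n) (ρ : CellsOp n)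
    {U : CellsOp n} (hU : U ∈ 𝒰) : energy ρ - energy (U * ρ * Uᴴ) ≤ extractableWork 𝒰 ρ :=
  le_ciSup (bddAbove_work h𝒰 ρ) (⟨U, hU⟩ : 𝒰)

theorem localErgotropy_le_ergotropy (ρ : CellsOp n) : localErgotropy ρ ≤ ergotropy ρ :=
  extractableWork_le (localUnitaries_nonempty n) fun _ hU =>
    le_extractableWork subset_rfl ρ (localUnitaries_subset n hU)

theorem ergotropy_le_energy {ρ : CellsOp n} (hρ : ρ.PosSemidef) : ergotropy ρ ≤ energy ρ :=
  extractableWork_le (globalUnitaries_nonempty n) fun U _ =>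
    sub_le_self _ (energy_nonneg (hρ.mul_mul_conjTranspose_same U))

theorem energy_channelPower_adc (γ : ℝ) (ρ : CellsOp n) :
    energy (channelPower (adc γ) n ρ) = (1 - γ) * energy ρ := by
  simp only [energy_eq_sum_marginal, marginal_channelPower (trace_adc γ), Finset.mul_sum]
  simp [adc]

theorem ergotropy_channelPower_adc_le {γ : ℝ} (hγ₀ : 0 ≤ γ) (hγ₁ : γ ≤ 1) {ρ : CellsOp n}
    (hρ : ρ.PosSemidef) : ergotropy (channelPower (adc γ) n ρ) ≤ (1 - γ) * energy ρ :=
  energy_channelPower_adc γ ρ ▸ ergotropy_le_energy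
    (posSemidef_channelPower_of_kraus (adc_eq_sum_kraus hγ₀ hγ₁) hρ)

end ExtractableWork

section LocalBound

theorem sum_norm_sq_row {ι : Type*} [Fintype ι] [DecidableEq ι] {U : Matrix ι ι ℂ}
    (hU : U ∈ unitaryGroup ι ℂ) (s : ι) : ∑ t, ‖U s t‖ ^ 2 = 1 := by
  have h := congrFun (congrFun (mem_unitaryGroup_iff.1 hU) s) s
  simp only [mul_apply, star_apply, one_apply_eq, RCLike.star_def, Complex.mul_conj,
    Complex.normSq_eq_norm_sq] at h
  exact_mod_cast h

theorem re_conj_apply_one_one {τ : QubitOp} (hτ : τ.IsHermitian) (V : QubitOp) :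
    ((V * τ * Vᴴ) 1 1).re = ‖V 1 0‖ ^ 2 * (τ 0 0).re + ‖V 1 1‖ ^ 2 * (τ 1 1).re
      + 2 * (V 1 0 * τ 0 1 * star (V 1 1)).re := by
  have him (i : Fin 2) : (τ i i).im = 0 := Complex.conj_eq_iff_im.1 (hτ.apply i i)
  simp only [mul_apply, Fin.sum_univ_two, conjTranspose_apply, ← hτ.apply 1 0,
    ← Complex.normSq_eq_norm_sq, Complex.normSq_apply]
  simp [him]
  ring

theorem IsDensity.sub_re_conj_apply_one_one_le {τ : QubitOp} (hτ : IsDensity τ) {V : QubitOp}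
    (hV : V ∈ unitaryGroup (Fin 2) ℂ) :
    (τ 1 1).re - ((V * τ * Vᴴ) 1 1).re
      ≤ ‖V 1 0‖ ^ 2 * (2 * (τ 1 1).re - 1) + 2 * (‖V 1 0‖ * ‖V 1 1‖ * ‖τ 0 1‖) := by
  have hrow := sum_norm_sq_row hV 1
  have hcoh := (abs_le.1 (Complex.abs_re_le_norm (V 1 0 * τ 0 1 * star (V 1 1)))).1
  rw [Fin.sum_univ_two] at hrow
  rw [norm_mul, norm_mul, norm_star] at hcoh
  rw [re_conj_apply_one_one hτ.1.1, hτ.re_apply_zero_zero, ← sub_eq_iff_eq_add'.2 hrow.symm]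
  linarith

/-- The common value of the restricted work/energy ratios of the generalized amplitude damping
channel. -/
noncomputable def workRatio (γ η : ℝ) : ℝ := (1 - γ) / (1 - 2 * η * γ)

variable {γ η : ℝ}

theorem workRatio_nonneg (hγ₁ : γ ≤ 1) (hX : 0 < 1 - 2 * η * γ) : 0 ≤ workRatio γ η :=
  div_nonneg (sub_nonneg.2 hγ₁) hX.le

theorem mul_workRatio (hX : 0 < 1 - 2 * η * γ) : (1 - 2 * η * γ) * workRatio γ η = 1 - γ :=
  mul_div_cancel₀ _ hX.ne'

theorem two_mul_sub_le_workRatio (hγ₀ : 0 ≤ γ) (hγ₁ : γ ≤ 1) (hX : 0 < 1 - 2 * η * γ) :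
    2 * (1 - γ) - (1 - 2 * η * γ) ≤ workRatio γ η := by
  rw [workRatio, le_div_iff₀ hX]
  nlinarith [sq_nonneg (1 - 2 * η * γ - (1 - γ)), mul_nonneg (sub_nonneg.2 hγ₁) hγ₀]

theorem coherence_le_workRatio {p r m e : ℝ} (hγ₁ : γ ≤ 1) (hX : 0 < 1 - 2 * η * γ)
    (he₀ : 0 ≤ e) (he₁ : e ≤ 1) (hm : m ^ 2 ≤ (1 - γ) * (e * (1 - e))) :
    2 * (p * r * m) ≤ p ^ 2 * ((1 - 2 * η * γ) * (1 - e)) + r ^ 2 * (workRatio γ η * e) := by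
  have ha := sub_nonneg.2 hγ₁
  have hc := workRatio_nonneg hγ₁ hX
  have he := sub_nonneg.2 he₁
  have hprod : (p * r * m) ^ 2
      ≤ p ^ 2 * ((1 - 2 * η * γ) * (1 - e)) * (r ^ 2 * (workRatio γ η * e)) := by
    calc (p * r * m) ^ 2 = (p * r) ^ 2 * m ^ 2 := by ring
      _ ≤ (p * r) ^ 2 * ((1 - γ) * (e * (1 - e))) := by gcongr
      _ = _ := by rw [← mul_workRatio hX]; ring
  refine le_of_sq_le_sq ?_ (by positivity)
  nlinarith [sq_nonneg (p ^ 2 * ((1 - 2 * η * γ) * (1 - e)) - r ^ 2 * (workRatio γ η * e))]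

theorem gadc_sub_conj_apply_one_one_le (hγ₀ : 0 ≤ γ) (hγ₁ : γ ≤ 1) (hη₀ : 0 ≤ η) (hη₁ : η ≤ 1)
    (hX : 0 < 1 - 2 * η * γ) {σ : QubitOp} (hσ : IsDensity σ) {V : QubitOp}
    (hV : V ∈ unitaryGroup (Fin 2) ℂ) :
    (gadc γ η σ 1 1).re - ((V * gadc γ η σ * Vᴴ) 1 1).re ≤ workRatio γ η * (σ 1 1).re := by
  have hrow := sum_norm_sq_row hV 1
  rw [Fin.sum_univ_two] at hrow
  have hcoh : ‖gadc γ η σ 0 1‖ ^ 2 ≤ (1 - γ) * ((σ 1 1).re * (1 - (σ 1 1).re)) := by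
    rw [norm_sq_gadc_apply_zero_one hγ₁]
    exact mul_le_mul_of_nonneg_left hσ.norm_sq_apply_zero_one_le (sub_nonneg.2 hγ₁)
  have hwork := (isDensity_gadc hγ₀ hγ₁ hη₀ hη₁ hσ).sub_re_conj_apply_one_one_le hV
  have hAMGM := coherence_le_workRatio (p := ‖V 1 0‖) (r := ‖V 1 1‖) hγ₁ hX
    hσ.re_apply_one_one_nonneg hσ.re_apply_one_one_le_one hcoh
  have hslack := mul_le_mul_of_nonneg_left (two_mul_sub_le_workRatio hγ₀ hγ₁ hX)
    (mul_nonneg (sq_nonneg ‖V 1 0‖) hσ.re_apply_one_one_nonneg)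
  rw [re_gadc_apply_one_one γ η hσ.2] at hwork ⊢
  rw [eq_sub_of_add_eq' hrow] at hAMGM
  linarith

theorem localErgotropy_channelPower_gadc_le (hγ₀ : 0 ≤ γ) (hγ₁ : γ ≤ 1) (hη₀ : 0 ≤ η)
    (hη₁ : η ≤ 1) (hX : 0 < 1 - 2 * η * γ) {n : ℕ} {ρ : CellsOp n} (hρ : IsDensity ρ) :
    localErgotropy (channelPower (gadc γ η) n ρ) ≤ workRatio γ η * energy ρ := by
  refine extractableWork_le (localUnitaries_nonempty n) ?_
  rintro _ ⟨V, hV, rfl⟩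
  simp only [energy_eq_sum_marginal, marginal_tensor_conj hV,
    marginal_channelPower (trace_gadc γ η), Finset.mul_sum, ← Finset.sum_sub_distrib]
  exact Finset.sum_le_sum fun i _ =>
    gadc_sub_conj_apply_one_one_le hγ₀ hγ₁ hη₀ hη₁ hX (hρ.marginal i) (hV i)

end LocalBound

section ArtanhInequality

open Real

theorem convexOn_sinh : ConvexOn ℝ (Set.Ici 0) sinh := by
  refine MonotoneOn.convexOn_of_deriv (convex_Ici 0) continuous_sinh.continuousOn
    differentiable_sinh.differentiableOn ?_
  rw [Real.deriv_sinh, interior_Ici]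
  exact cosh_strictMonoOn.monotoneOn.mono Set.Ioi_subset_Ici_self

theorem mul_sinh_le_mul_sinh {s t : ℝ} (hs : 0 ≤ s) (hst : s ≤ t) :
    t * sinh s ≤ s * sinh t := by
  rcases hs.eq_or_lt with rfl | hs
  · simp
  have hsecant := convexOn_sinh.secant_mono (Set.mem_Ici.2 le_rfl) (Set.mem_Ici.2 hs.le)
    (Set.mem_Ici.2 (hs.le.trans hst)) hs.ne' (hs.trans_le hst).ne' hst
  simp only [sinh_zero, sub_zero] at hsecant
  linarith [(div_le_div_iff₀ hs (hs.trans_le hst)).1 hsecant]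

theorem sqrt_mul_artanh_mul_le {X L : ℝ} (hX : 0 < X) (hXL : X ≤ L) (hL : L < 1) :
    √(1 - L ^ 2) * artanh L * X ≤ √(1 - X ^ 2) * artanh X * L := by
  have hX₁ : 0 < √(1 - X ^ 2) := sqrt_pos.2 (by nlinarith)
  have hL₁ : 0 < √(1 - L ^ 2) := sqrt_pos.2 (by nlinarith)
  have h := mul_sinh_le_mul_sinh (artanh_nonneg hX.le) (artanh_le_artanh (by linarith) hL hXL)
  rw [sinh_artanh ⟨by linarith, by linarith⟩, sinh_artanh ⟨by linarith, hL⟩, ← mul_div_assoc,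
    ← mul_div_assoc, div_le_div_iff₀ hX₁ hL₁] at h
  linarith

theorem mul_mul_artanh_le {X L K w : ℝ} (hX : 0 < X) (hL₀ : 0 < L) (hL₁ : L < 1) (hw : w ≤ 1)
    (hK : 0 ≤ K) (hXK : X ^ 2 + K ≤ 1) (hL : L ^ 2 = X ^ 2 + K * (1 - w ^ 2)) :
    w * X * artanh L ≤ L * artanh X := by
  have hartX := artanh_nonneg hX.le
  have hartL := artanh_nonneg hL₀.le
  rcases le_total w 0 with hw₀ | hw₀
  · exact (mul_nonpos_of_nonpos_of_nonneg (mul_nonpos_of_nonpos_of_nonneg hw₀ hX.le) hartL).trans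
      (mul_nonneg hL₀.le hartX)
  have hw₂ : 0 ≤ 1 - w ^ 2 := by nlinarith
  have hXL : X ≤ L := le_of_sq_le_sq (by nlinarith) hL₀.le
  have hX₁ : 0 < √(1 - X ^ 2) := sqrt_pos.2 (by nlinarith)
  have hw_sqrt : w * √(1 - X ^ 2) ≤ √(1 - L ^ 2) := by
    refine le_sqrt_of_sq_le ?_
    rw [mul_pow, sq_sqrt (by nlinarith)]
    nlinarith
  refine le_of_mul_le_mul_left ?_ hX₁
  calc √(1 - X ^ 2) * (w * X * artanh L) = w * √(1 - X ^ 2) * (X * artanh L) := by ring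
    _ ≤ √(1 - L ^ 2) * (X * artanh L) := by gcongr
    _ ≤ √(1 - X ^ 2) * (L * artanh X) := by linarith [sqrt_mul_artanh_mul_le hX hXL hL₁]

end ArtanhInequality

section EntropyTangent

open Real

theorem log_div_one_add_one_sub {L : ℝ} (hL : L ∈ Set.Ioo (-1) 1) :
    log (1 - (1 - L) / 2) - log ((1 - L) / 2) = 2 * artanh L := by
  rw [artanh_eq_half_log ⟨hL.1.le, hL.2.le⟩, ← log_div (by linarith [hL.1]) (by linarith [hL.2]),
    show (1 - (1 - L) / 2) / ((1 - L) / 2) = (1 + L) / (1 - L) by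
      have := sub_pos.2 hL.2
      field_simp
      ring]
  ring

theorem hasDerivAt_binEntropy_sqrt {u : ℝ} (hu₀ : 0 < u) (hu₁ : u < 1) :
    HasDerivAt (fun v => binEntropy ((1 - √v) / 2)) (-(artanh √u / (2 * √u))) u := by
  have hL₀ : 0 < √u := sqrt_pos.2 hu₀
  have hL₁ : √u < 1 := by rwa [sqrt_lt' one_pos, one_pow]
  have h := (hasDerivAt_binEntropy (p := (1 - √u) / 2) (by linarith) (by linarith)).comp u
    (((hasDerivAt_sqrt hu₀.ne').const_sub 1).div_const 2)
  rw [log_div_one_add_one_sub ⟨by linarith, hL₁⟩] at h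
  exact h.congr_deriv (by field_simp)

/-- The squared Bloch length of the image under the generalized amplitude damping channel of a pure
cell state of energy `e`. -/
noncomputable def blochSq (γ η e : ℝ) : ℝ :=
  (1 - 2 * η * γ - 2 * (1 - γ) * e) ^ 2 + 4 * (1 - γ) * e * (1 - e)

variable {γ η e : ℝ}

theorem hasDerivAt_blochSq (hη : 0 < η) :
    HasDerivAt (blochSq γ η) (4 * (1 - γ) * (2 * η * γ) * (1 - e / η)) e := by
  have hbias := ((hasDerivAt_id e).const_mul (2 * (1 - γ))).const_sub (1 - 2 * η * γ)
  have hcoh := ((hasDerivAt_id e).const_mul (4 * (1 - γ))).mul ((hasDerivAt_id e).const_sub 1)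
  refine ((hbias.pow 2).add hcoh).congr_deriv ?_
  simp only [id]
  field_simp
  ring

theorem one_sub_blochSq (γ η e : ℝ) :
    1 - blochSq γ η e = 4 * γ * (η * (1 - η) + (1 - γ) * (η - e) ^ 2) := by
  rw [blochSq]
  ring

theorem blochSq_le_one (hγ₀ : 0 ≤ γ) (hγ₁ : γ ≤ 1) (hη₀ : 0 ≤ η) (hη₁ : η ≤ 1) :
    blochSq γ η e ≤ 1 := by
  have hγ := sub_nonneg.2 hγ₁
  have hη := sub_nonneg.2 hη₁
  rw [← sub_nonneg, one_sub_blochSq]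
  positivity

theorem blochSq_lt_one (hγ₀ : 0 < γ) (hγ₁ : γ ≤ 1) (hη₀ : 0 < η) (hη₁ : η ≤ 1)
    (hX : 0 < 1 - 2 * η * γ) (he : e < 1) : blochSq γ η e < 1 := by
  rw [← sub_pos, one_sub_blochSq]
  refine mul_pos (by positivity) ?_
  rcases hη₁.eq_or_lt with rfl | hη₁
  · have := mul_pos (show 0 < 1 - γ by linarith) (pow_pos (sub_pos.2 he) 2)
    linarith
  · nlinarith [mul_pos hη₀ (sub_pos.2 hη₁), mul_nonneg (sub_nonneg.2 hγ₁) (sq_nonneg (η - e))]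

theorem blochSq_pos (hγ₁ : γ ≤ 1) (hX : 0 < 1 - 2 * η * γ) (he₀ : 0 < e) (he₁ : e < 1) :
    0 < blochSq γ η e := by
  rw [blochSq]
  rcases hγ₁.eq_or_lt with rfl | hγ₁
  · rw [sub_self]
    nlinarith
  · have := mul_pos (mul_pos (mul_pos four_pos (sub_pos.2 hγ₁)) he₀) (sub_pos.2 he₁)
    positivity

theorem mul_artanh_sqrt_blochSq_le (hγ₀ : 0 < γ) (hγ₁ : γ ≤ 1) (hη₀ : 0 < η) (hη₁ : η ≤ 1)
    (hX : 0 < 1 - 2 * η * γ) (he₀ : 0 < e) (he₁ : e < 1) :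
    (1 - e / η) * (1 - 2 * η * γ) * artanh √(blochSq γ η e)
      ≤ √(blochSq γ η e) * artanh (1 - 2 * η * γ) := by
  have hu := blochSq_pos hγ₁ hX he₀ he₁
  have hγ' := sub_nonneg.2 hγ₁
  refine mul_mul_artanh_le (K := 4 * (1 - γ) * γ * η ^ 2) hX (sqrt_pos.2 hu) ?_
    (sub_le_self _ (by positivity)) (by positivity) ?_ ?_
  · rw [sqrt_lt' one_pos, one_pow]
    exact blochSq_lt_one hγ₀ hγ₁ hη₀ hη₁ hX he₁
  · nlinarith [mul_nonneg (mul_nonneg hγ₀.le hη₀.le) (sub_nonneg.2 hη₁)]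
  · rw [sq_sqrt hu.le, blochSq]
    field_simp
    ring

theorem entropy_slope_nonneg (hγ₀ : 0 < γ) (hγ₁ : γ ≤ 1) (hη₀ : 0 < η) (hη₁ : η ≤ 1)
    (hX : 0 < 1 - 2 * η * γ) (he₀ : 0 < e) (he₁ : e < 1) :
    0 ≤ -(artanh √(blochSq γ η e) / (2 * √(blochSq γ η e)))
        * (4 * (1 - γ) * (2 * η * γ) * (1 - e / η))
      + 2 * artanh (1 - 2 * η * γ) * (2 * η * γ) * workRatio γ η := by
  have hL := sqrt_pos.2 (blochSq_pos hγ₁ hX he₀ he₁)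
  have htangent : (1 - e / η) * artanh √(blochSq γ η e) / √(blochSq γ η e)
      ≤ artanh (1 - 2 * η * γ) / (1 - 2 * η * γ) := by
    rw [div_le_div_iff₀ hL hX]
    linarith [mul_artanh_sqrt_blochSq_le hγ₀ hγ₁ hη₀ hη₁ hX he₀ he₁]
  have hnonneg : 0 ≤ 2 * (1 - γ) * (2 * η * γ) * (artanh (1 - 2 * η * γ) / (1 - 2 * η * γ)
      - (1 - e / η) * artanh √(blochSq γ η e) / √(blochSq γ η e)) :=
    mul_nonneg (mul_nonneg (by linarith) (by positivity)) (sub_nonneg.2 htangent)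
  exact hnonneg.trans_eq (by rw [workRatio]; ring)

theorem binEntropy_le_binEntropy_blochSq_add (hγ₀ : 0 < γ) (hγ₁ : γ ≤ 1) (hη₀ : 0 < η)
    (hη₁ : η ≤ 1) (hX : 0 < 1 - 2 * η * γ) (he₀ : 0 ≤ e) (he₁ : e ≤ 1) :
    binEntropy (γ * η) ≤ binEntropy ((1 - √(blochSq γ η e)) / 2)
      + 2 * artanh (1 - 2 * η * γ) * (2 * η * γ) * workRatio γ η * e := by
  have hmono : MonotoneOn (fun e => binEntropy ((1 - √(blochSq γ η e)) / 2)
      + 2 * artanh (1 - 2 * η * γ) * (2 * η * γ) * workRatio γ η * e) (Set.Icc 0 1) := by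
    refine monotoneOn_of_hasDerivWithinAt_nonneg (convex_Icc 0 1) ?_ (fun e he => ?_) fun e he =>
      entropy_slope_nonneg hγ₀ hγ₁ hη₀ hη₁ hX (interior_Icc.subset he).1 (interior_Icc.subset he).2
    · unfold blochSq
      fun_prop
    · rw [interior_Icc] at he
      have hslope := (hasDerivAt_id e).const_mul
        (2 * artanh (1 - 2 * η * γ) * (2 * η * γ) * workRatio γ η)
      have hentropy := (hasDerivAt_binEntropy_sqrt (blochSq_pos hγ₁ hX he.1 he.2)
        (blochSq_lt_one hγ₀ hγ₁ hη₀ hη₁ hX he.2)).comp e (hasDerivAt_blochSq hη₀)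
      rw [mul_one] at hslope
      exact (hentropy.add hslope).hasDerivWithinAt
  have h := hmono ⟨le_rfl, zero_le_one⟩ ⟨he₀, he₁⟩ he₀
  have h₀ : blochSq γ η 0 = (1 - 2 * η * γ) ^ 2 := by simp [blochSq]
  simp only [h₀, sqrt_sq hX.le, mul_zero, add_zero] at h
  rwa [show (1 - (1 - 2 * η * γ)) / 2 = γ * η by ring] at h

end EntropyTangent

section Gibbs

open Real

variable {ι : Type*} [Fintype ι] [DecidableEq ι]

theorem sum_norm_sq_column {U : Matrix ι ι ℂ} (hU : U ∈ unitaryGroup ι ℂ) (t : ι) :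
    ∑ s, ‖U s t‖ ^ 2 = 1 := by
  simpa [star_apply] using sum_norm_sq_row (Unitary.star_mem hU) t

theorem norm_sq_mem_doublyStochastic {U : Matrix ι ι ℂ} (hU : U ∈ unitaryGroup ι ℂ) :
    of (fun s t => ‖U s t‖ ^ 2) ∈ doublyStochastic ℝ ι :=
  mem_doublyStochastic_iff_sum.2
    ⟨fun _ _ => sq_nonneg _, sum_norm_sq_row hU, sum_norm_sq_column hU⟩

theorem re_conj_diagonal_apply_self (U : Matrix ι ι ℂ) (p : ι → ℝ) (s : ι) :
    ((U * diagonal (fun t => (p t : ℂ)) * Uᴴ) s s).re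
      = (of (fun s t => ‖U s t‖ ^ 2) *ᵥ p) s := by
  rw [mul_apply, Complex.re_sum]
  simp only [mul_diagonal, conjTranspose_apply, mulVec, dotProduct, of_apply]
  refine Finset.sum_congr rfl fun t _ => ?_
  rw [mul_right_comm, RCLike.star_def, Complex.mul_conj, Complex.normSq_eq_norm_sq]
  norm_cast

theorem negMulLog_le_mul_neg_log_add {p q : ℝ} (hp : 0 ≤ p) (hq : 0 < q) :
    negMulLog p ≤ p * -log q + (q - p) := by
  have h := mul_le_mul_of_nonneg_left (negMulLog_le_one_sub_self (div_nonneg hp hq.le)) hq.le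
  calc negMulLog p = p / q * negMulLog q + q * negMulLog (p / q) := by
        rw [← negMulLog_mul, mul_div_cancel₀ p hq.ne']
    _ ≤ p / q * negMulLog q + q * (1 - p / q) := by gcongr
    _ = _ := by rw [negMulLog]; field_simp

theorem sum_negMulLog_le_sum_mulVec_mul_neg_log {M : Matrix ι ι ℝ} (hM : M ∈ doublyStochastic ℝ ι)
    {p q : ι → ℝ} (hp : ∀ t, 0 ≤ p t) (hq : ∀ s, 0 < q s) (hqp : ∑ s, q s ≤ ∑ t, p t) :
    ∑ t, negMulLog (p t) ≤ ∑ s, (M *ᵥ p) s * -log (q s) := by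
  obtain ⟨hM₀, hrow, hcol⟩ := mem_doublyStochastic_iff_sum.1 hM
  have hsum (f : ι → ℝ) : ∑ s, ∑ t, M s t * f t = ∑ t, f t := by
    rw [Finset.sum_comm]
    simp only [← Finset.sum_mul, hcol, one_mul]
  calc ∑ t, negMulLog (p t) = ∑ s, ∑ t, M s t * negMulLog (p t) := (hsum _).symm
    _ ≤ ∑ s, ∑ t, M s t * (p t * -log (q s) + (q s - p t)) :=
        Finset.sum_le_sum fun s _ => Finset.sum_le_sum fun t _ =>
          mul_le_mul_of_nonneg_left (negMulLog_le_mul_neg_log_add (hp t) (hq s)) (hM₀ s t)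
    _ = ∑ s, (M *ᵥ p) s * -log (q s) + (∑ s, q s - ∑ t, p t) := by
        simp only [mulVec, dotProduct, mul_add, mul_sub, Finset.sum_add_distrib,
          Finset.sum_sub_distrib, ← mul_assoc, ← Finset.sum_mul, hrow, one_mul, hsum]
    _ ≤ _ := by linarith

end Gibbs

section ProductEntropy

open Real

variable {n : ℕ}

theorem sum_negMulLog_prod {p : Fin n → Fin 2 → ℝ} (hp : ∀ i, ∑ k, p i k = 1) :
    ∑ s : Fin n → Fin 2, negMulLog (∏ i, p i (s i)) = ∑ i, ∑ k, negMulLog (p i k) := by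
  have hlog (s : Fin n → Fin 2) : negMulLog (∏ i, p i (s i))
      = ∑ i, (∏ j, p j (s j)) * -log (p i (s i)) := by
    by_cases h₀ : ∏ i, p i (s i) = 0
    · simp [h₀]
    · rw [negMulLog, log_prod fun i hi => Finset.prod_ne_zero_iff.1 h₀ i hi, ← Finset.mul_sum,
        Finset.sum_neg_distrib, neg_mul_comm]
  have hmarginal (i : Fin n) : marginal i (diagonal fun s => ((∏ j, p j (s j) : ℝ) : ℂ))
      = diagonal fun k => (p i k : ℂ) := by
    have htrace (j : Fin n) : ∑ k, (p j k : ℂ) = 1 := by exact_mod_cast hp j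
    push_cast
    rw [← tensor_diagonal fun j k => (p j k : ℂ), marginal_tensor]
    simp only [trace_diagonal, htrace, Finset.prod_const_one, one_smul]
  rw [Finset.sum_congr rfl fun s _ => hlog s, Finset.sum_comm]
  refine Finset.sum_congr rfl fun i _ => ?_
  have h := sum_diag_mul_apply (diagonal fun s => ((∏ j, p j (s j) : ℝ) : ℂ)) i
    fun k => -log (p i k)
  simpa only [hmarginal, diagonal_apply_eq, Complex.ofReal_re, negMulLog, neg_mul_comm] using h

theorem sum_diag_mul_neg_log_thermal {x : ℝ} (hx₀ : 0 < x) (hx₁ : x < 1) {ρ : CellsOp n}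
    (hρ : IsDensity ρ) :
    ∑ s, (ρ s s).re * -log (∏ i, ![1 - x, x] (s i))
      = (log (1 - x) - log x) * energy ρ - n * log (1 - x) := by
  have hne (k : Fin 2) : ![1 - x, x] k ≠ 0 := by
    fin_cases k
    exacts [(sub_pos.2 hx₁).ne', hx₀.ne']
  have hlog (s : Fin n → Fin 2) :
      -log (∏ i, ![1 - x, x] (s i)) = ∑ i, -log (![1 - x, x] (s i)) := by
    rw [log_prod fun i _ => hne (s i), Finset.sum_neg_distrib]
  simp only [hlog, Finset.mul_sum]
  rw [Finset.sum_comm, energy_eq_sum_marginal, Finset.mul_sum]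
  have hcell (i : Fin n) : ∑ s, (ρ s s).re * -log (![1 - x, x] (s i))
      = (log (1 - x) - log x) * (marginal i ρ 1 1).re - log (1 - x) := by
    rw [sum_diag_mul_apply ρ i fun k => -log (![1 - x, x] k), Fin.sum_univ_two,
      (hρ.marginal i).re_apply_zero_zero]
    simp only [cons_val_zero, cons_val_one]
    ring
  simp only [hcell, Finset.sum_sub_distrib, Finset.sum_const, Finset.card_univ, Fintype.card_fin,
    nsmul_eq_mul]

/-- The von Neumann entropy `-Tr[ρ log ρ]` (in nats), computed from the spectrum of `ρ`. -/
noncomputable def vonNeumannEntropy {ι : Type*} [Fintype ι] [DecidableEq ι] {ρ : Matrix ι ι ℂ}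
    (hρ : ρ.IsHermitian) : ℝ :=
  ∑ k, negMulLog (hρ.eigenvalues k)

theorem tensor_eq_conj_diagonal {τ : Fin n → QubitOp} (hτ : ∀ i, (τ i).IsHermitian) :
    tensor τ = tensor (fun i => ((hτ i).eigenvectorUnitary : QubitOp))
      * diagonal (fun s => ((∏ i, (hτ i).eigenvalues (s i) : ℝ) : ℂ))
      * (tensor fun i => ((hτ i).eigenvectorUnitary : QubitOp))ᴴ := by
  push_cast
  rw [← tensor_diagonal fun i k => ((hτ i).eigenvalues k : ℂ), conjTranspose_tensor, tensor_mul,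
    tensor_mul]
  exact congrArg tensor (funext fun i => (hτ i).spectral_theorem)

theorem sum_eigenvalues_eq_one {ι : Type*} [Fintype ι] [DecidableEq ι] {ρ : Matrix ι ι ℂ}
    (hρ : IsDensity ρ) : ∑ k, hρ.1.1.eigenvalues k = 1 := by
  have h := hρ.2.symm.trans hρ.1.1.trace_eq_sum_eigenvalues
  simpa using congrArg Complex.re h.symm

theorem IsDensity.unitary_conj {ι : Type*} [Fintype ι] [DecidableEq ι] {ρ U : Matrix ι ι ℂ}
    (hρ : IsDensity ρ) (hU : U ∈ unitaryGroup ι ℂ) : IsDensity (U * ρ * Uᴴ) :=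
  ⟨hρ.1.mul_mul_conjTranspose_same U, by rw [trace_unitary_conj hU, hρ.2]⟩

theorem isDensity_tensor {τ : Fin n → QubitOp} (hτ : ∀ i, IsDensity (τ i)) :
    IsDensity (tensor τ) := by
  refine ⟨?_, by simp [trace_tensor, (hτ _).2]⟩
  rw [tensor_eq_conj_diagonal fun i => (hτ i).1.1]
  exact (PosSemidef.diagonal fun s => Complex.zero_le_real.2 <|
    Finset.prod_nonneg fun i _ => (hτ i).1.eigenvalues_nonneg _).mul_mul_conjTranspose_same _

theorem sum_vonNeumannEntropy_le {x : ℝ} (hx₀ : 0 < x) (hx₁ : x < 1) {τ : Fin n → QubitOp}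
    (hτ : ∀ i, IsDensity (τ i)) {U : CellsOp n} (hU : U ∈ unitaryGroup (Fin n → Fin 2) ℂ) :
    ∑ i, vonNeumannEntropy (hτ i).1.1
      ≤ (log (1 - x) - log x) * energy (U * tensor τ * Uᴴ) - n * log (1 - x) := by
  have hthermal (k : Fin 2) : 0 < ![1 - x, x] k := by
    fin_cases k
    exacts [sub_pos.2 hx₁, hx₀]
  set W := tensor fun i => ((hτ i).1.1.eigenvectorUnitary : QubitOp)
  set p : (Fin n → Fin 2) → ℝ := fun s => ∏ i, (hτ i).1.1.eigenvalues (s i)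
  have hdiag : U * tensor τ * Uᴴ = (U * W) * diagonal (fun s => (p s : ℂ)) * (U * W)ᴴ := by
    rw [tensor_eq_conj_diagonal fun i => (hτ i).1.1, conjTranspose_mul]
    simp only [mul_assoc, W, p]
  have hUW : U * W ∈ unitaryGroup (Fin n → Fin 2) ℂ := mul_mem hU <|
    localUnitaries_subset n ⟨_, fun i => (hτ i).1.1.eigenvectorUnitary.2, rfl⟩
  have hsum (q : Fin n → Fin 2 → ℝ) (hq : ∀ i, ∑ k, q i k = 1) :
      ∑ s : Fin n → Fin 2, ∏ i, q i (s i) = 1 := by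
    rw [← Fintype.prod_sum, Finset.prod_congr rfl fun i _ => hq i, Finset.prod_const_one]
  have hsum_p := hsum _ fun i => sum_eigenvalues_eq_one (hτ i)
  have hsum_thermal := hsum (fun _ => ![1 - x, x]) fun _ => by simp
  rw [← sum_diag_mul_neg_log_thermal hx₀ hx₁ ((isDensity_tensor hτ).unitary_conj hU), hdiag]
  simp only [vonNeumannEntropy, re_conj_diagonal_apply_self,
    ← sum_negMulLog_prod fun i => sum_eigenvalues_eq_one (hτ i)]
  exact sum_negMulLog_le_sum_mulVec_mul_neg_log (norm_sq_mem_doublyStochastic hUW)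
    (fun s => Finset.prod_nonneg fun i _ => (hτ i).1.eigenvalues_nonneg _)
    (fun s => Finset.prod_pos fun i _ => hthermal _) (hsum_thermal.trans hsum_p.symm).le

end ProductEntropy

section SeparableBound

open Real

theorem binEntropy_le_binEntropy_of_sq_le {u p : ℝ} (hu : u ≤ 1) (hp : p ∈ Set.Icc 0 1)
    (h : (1 - 2 * p) ^ 2 ≤ u) : binEntropy ((1 - √u) / 2) ≤ binEntropy p := by
  wlog hp₂ : p ≤ 1 / 2 generalizing p
  · rw [← binEntropy_one_sub p]
    exact this ⟨by linarith [hp.2], by linarith [hp.1]⟩ (by linarith) (by linarith)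
  exact binEntropy_strictMonoOn.monotoneOn
    ⟨by linarith [sqrt_le_one.2 hu], by linarith [sqrt_nonneg u]⟩ ⟨hp.1, by linarith⟩
    (by linarith [le_sqrt_of_sq_le h])

theorem binEntropy_le_vonNeumannEntropy {τ : QubitOp} (hτ : IsDensity τ) {u : ℝ} (hu : u ≤ 1)
    (h : 1 - u ≤ 4 * τ.det.re) : binEntropy ((1 - √u) / 2) ≤ vonNeumannEntropy hτ.1.1 := by
  have hsum := sum_eigenvalues_eq_one hτ
  have hdet : τ.det.re = hτ.1.1.eigenvalues 0 * hτ.1.1.eigenvalues 1 := by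
    rw [hτ.1.1.det_eq_prod_eigenvalues, Fin.prod_univ_two]
    simp
  rw [Fin.sum_univ_two, ← eq_sub_iff_add_eq'] at hsum
  rw [hdet, hsum] at h
  rw [vonNeumannEntropy, Fin.sum_univ_two, hsum, ← binEntropy_eq_negMulLog_add_negMulLog_one_sub]
  exact binEntropy_le_binEntropy_of_sq_le hu ⟨hτ.1.eigenvalues_nonneg 0,
    sub_nonneg.1 (hsum ▸ hτ.1.eigenvalues_nonneg 1)⟩ (by linarith)

variable {γ η : ℝ}

theorem one_sub_blochSq_le_det_gadc (hγ₁ : γ ≤ 1) {σ : QubitOp} (hσ : IsDensity σ)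
    (hΦ : IsDensity (gadc γ η σ)) :
    1 - blochSq γ η (σ 1 1).re ≤ 4 * (gadc γ η σ).det.re := by
  have hcoh := mul_le_mul_of_nonneg_left hσ.norm_sq_apply_zero_one_le (sub_nonneg.2 hγ₁)
  rw [hΦ.re_det, re_gadc_apply_one_one γ η hσ.2, norm_sq_gadc_apply_zero_one hγ₁, blochSq]
  linarith

theorem binEntropy_le_vonNeumannEntropy_gadc_add (hγ₀ : 0 < γ) (hγ₁ : γ ≤ 1) (hη₀ : 0 < η)
    (hη₁ : η ≤ 1) (hX : 0 < 1 - 2 * η * γ) {σ : QubitOp} (hσ : IsDensity σ)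
    (hΦ : IsDensity (gadc γ η σ)) :
    binEntropy (γ * η) ≤ vonNeumannEntropy hΦ.1.1
      + 2 * artanh (1 - 2 * η * γ) * (2 * η * γ) * workRatio γ η * (σ 1 1).re :=
  (binEntropy_le_binEntropy_blochSq_add hγ₀ hγ₁ hη₀ hη₁ hX hσ.re_apply_one_one_nonneg
    hσ.re_apply_one_one_le_one).trans <| add_le_add_left (binEntropy_le_vonNeumannEntropy hΦ
      (blochSq_le_one hγ₀.le hγ₁ hη₀.le hη₁) (one_sub_blochSq_le_det_gadc hγ₁ hσ hΦ)) _

theorem energy_tensor_gadc_sub_le (hγ₀ : 0 < γ) (hγ₁ : γ ≤ 1) (hη₀ : 0 < η) (hη₁ : η ≤ 1)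
    (hX : 0 < 1 - 2 * η * γ) {n : ℕ} {σ : Fin n → QubitOp} (hσ : ∀ i, IsDensity (σ i))
    {U : CellsOp n} (hU : U ∈ unitaryGroup (Fin n → Fin 2) ℂ) :
    energy (tensor fun i => gadc γ η (σ i)) - energy (U * (tensor fun i => gadc γ η (σ i)) * Uᴴ)
      ≤ workRatio γ η * energy (tensor σ) := by
  have hΦ i := isDensity_gadc hγ₀.le hγ₁ hη₀.le hη₁ (hσ i)
  have hx : γ * η < 1 := by linarith
  have hX₁ : 1 - 2 * η * γ < 1 := by linarith [mul_pos hη₀ hγ₀]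
  have hβ : log (1 - γ * η) - log (γ * η) = 2 * artanh (1 - 2 * η * γ) := by
    rw [← log_div_one_add_one_sub ⟨by linarith, hX₁⟩]
    ring_nf
  have hent := Finset.sum_le_sum fun i (_ : i ∈ Finset.univ) =>
    binEntropy_le_vonNeumannEntropy_gadc_add hγ₀ hγ₁ hη₀ hη₁ hX (hσ i) (hΦ i)
  have hvar := sum_vonNeumannEntropy_le (mul_pos hγ₀ hη₀) hx hΦ hU
  have hbin : binEntropy (γ * η)
      = 2 * artanh (1 - 2 * η * γ) * (γ * η) - log (1 - γ * η) := by
    rw [← hβ, binEntropy_eq_negMulLog_add_negMulLog_one_sub, negMulLog, negMulLog]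
    ring
  rw [hβ] at hvar
  simp only [hbin, Finset.sum_add_distrib, ← Finset.mul_sum, Finset.sum_const, Finset.card_univ,
    Fintype.card_fin, nsmul_eq_mul, ← energy_tensor fun i => (hσ i).2] at hent
  have hout : energy (tensor fun i => gadc γ η (σ i))
      = n * (γ * η) + (1 - 2 * η * γ) * workRatio γ η * energy (tensor σ) := by
    rw [mul_workRatio hX, energy_tensor fun i => (hΦ i).2, energy_tensor fun i => (hσ i).2]
    simp [re_gadc_apply_one_one γ η (hσ _).2, Finset.sum_add_distrib, Finset.mul_sum]
  refine le_of_mul_le_mul_left ?_ (mul_pos two_pos (artanh_pos ⟨hX, hX₁⟩))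
  rw [hout]
  linarith

theorem ergotropy_channelPower_gadc_le_of_isSeparable_of_pos (hγ₀ : 0 < γ) (hγ₁ : γ ≤ 1)
    (hη₀ : 0 < η) (hη₁ : η ≤ 1) (hX : 0 < 1 - 2 * η * γ) {n : ℕ} {ρ : CellsOp n}
    (hρ : IsSeparable ρ) :
    ergotropy (channelPower (gadc γ η) n ρ) ≤ workRatio γ η * energy ρ := by
  refine extractableWork_le (globalUnitaries_nonempty n) fun U hU => ?_
  have hlin : IsLinearMap ℝ fun ρ : CellsOp n => energy (channelPower (gadc γ η) n ρ)
      - energy (U * channelPower (gadc γ η) n ρ * Uᴴ) - workRatio γ η * energy ρ := by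
    simp only [← channelPowerLin_apply]
    constructor
    · intro ρ σ
      simp only [energy, map_add, mul_add, add_mul, trace_add, Complex.add_re]
      ring
    · intro r ρ
      simp only [energy, LinearMap.map_smul_of_tower, Matrix.mul_smul, Matrix.smul_mul,
        trace_smul, Complex.smul_re, smul_eq_mul]
      ring
  refine sub_nonpos.1 (convexHull_min ?_ (convex_halfSpace_le hlin 0) hρ)
  rintro _ ⟨σ, hσ, rfl⟩
  rw [Set.mem_ofPred_eq, channelPower_tensor]
  exact sub_nonpos.2 (energy_tensor_gadc_sub_le hγ₀ hγ₁ hη₀ hη₁ hX hσ hU)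

theorem ergotropy_channelPower_gadc_le_of_isSeparable (hγ₀ : 0 ≤ γ) (hγ₁ : γ ≤ 1) (hη₀ : 0 ≤ η)
    (hη₁ : η ≤ 1) (hX : 0 < 1 - 2 * η * γ) {n : ℕ} {ρ : CellsOp n} (hρ : IsDensity ρ)
    (hsep : IsSeparable ρ) :
    ergotropy (channelPower (gadc γ η) n ρ) ≤ workRatio γ η * energy ρ := by
  by_cases h : γ * η = 0
  · have hratio : workRatio γ η = 1 - γ := by
      rw [workRatio, show 1 - 2 * η * γ = 1 by linarith, div_one]
    rw [gadc_eq_adc h, hratio]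
    exact ergotropy_channelPower_adc_le hγ₀ hγ₁ hρ.1
  · obtain ⟨hγ, hη⟩ := mul_ne_zero_iff.1 h
    exact ergotropy_channelPower_gadc_le_of_isSeparable_of_pos (hγ₀.lt_of_ne' hγ) hγ₁
      (hη₀.lt_of_ne' hη) hη₁ hX hsep

end SeparableBound

section CoherentInputs

variable {e : ℝ}

theorem coherentState_apply_one_one (he₀ : 0 ≤ e) : coherentState e 1 1 = e := by
  rw [← Real.mul_self_sqrt he₀]
  simp [coherentState, vecMulVec_apply]

theorem re_coherentState_apply_zero_one : (coherentState e 0 1).re = √(1 - e) * √e := by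
  simp [coherentState, vecMulVec_apply]

theorem isDensity_coherentState (he₀ : 0 ≤ e) (he₁ : e ≤ 1) : IsDensity (coherentState e) := by
  have h : coherentState e 0 0 = (1 - e : ℝ) := by
    rw [← Real.mul_self_sqrt (sub_nonneg.2 he₁)]
    simp [coherentState, vecMulVec_apply]
  refine ⟨posSemidef_vecMulVec_self_star _, ?_⟩
  rw [trace_fin_two, h, coherentState_apply_one_one he₀]
  simp

theorem energy_coherentInput {n : ℕ} {E : ℝ} (hE : 0 < E) (hn : E ≤ n) :
    energy (coherentInput n E) = E := by
  have hn₀ : (0 : ℝ) < n := hE.trans_le hn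
  have he₀ : 0 ≤ E / n := by positivity
  rw [coherentInput,
    energy_tensor fun _ => (isDensity_coherentState he₀ ((div_le_one hn₀).2 hn)).2]
  simp [coherentState_apply_one_one he₀, mul_div_cancel₀ _ hn₀.ne']

theorem coherentInput_mem_separableStates {n : ℕ} {E : ℝ} (hE : 0 < E) (hn : E ≤ n) :
    coherentInput n E ∈ separableStates n E := by
  have hn₀ : (0 : ℝ) < n := hE.trans_le hn
  have hd := isDensity_coherentState (by positivity) ((div_le_one hn₀).2 hn)
  exact ⟨⟨isDensity_tensor fun _ => hd, (energy_coherentInput hE hn).le⟩,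
    subset_convexHull ℝ _ ⟨_, fun _ => hd, rfl⟩⟩

theorem exists_unitary_sub_re_conj_eq {τ : QubitOp} (hτ : IsDensity τ) (t : ℝ) :
    ∃ V ∈ unitaryGroup (Fin 2) ℂ, (τ 1 1).re - ((V * τ * Vᴴ) 1 1).re
      = (t ^ 2 * (2 * (τ 1 1).re - 1) + 2 * t * (τ 0 1).re) / (1 + t ^ 2) := by
  set k := (√(1 + t ^ 2))⁻¹
  have hk : k ^ 2 * (1 + t ^ 2) = 1 := by
    rw [inv_pow, Real.sq_sqrt (by positivity), inv_mul_cancel₀ (by positivity)]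
  refine ⟨(k : ℂ) • !![1, (t : ℂ); (-t : ℂ), 1], ?_, ?_⟩
  · have hkC : (k : ℂ) ^ 2 * (1 + (t : ℂ) ^ 2) = 1 := by exact_mod_cast hk
    rw [mem_unitaryGroup_iff]
    ext i j
    fin_cases i <;> fin_cases j <;> simp [mul_apply, Fin.sum_univ_two]
    · linear_combination hkC
    · ring
    · ring
    · linear_combination hkC
  · rw [re_conj_apply_one_one hτ.1.1, hτ.re_apply_zero_zero, eq_div_iff (by positivity)]
    simp [mul_pow]
    linear_combination
      (-(t ^ 2 * (1 - (τ 1 1).re)) - (τ 1 1).re + 2 * t * (τ 0 1).re) * hk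

variable {γ η : ℝ}

theorem exists_unitary_coherentState_work_ge (hγ₀ : 0 ≤ γ) (hγ₁ : γ ≤ 1) (hη₀ : 0 ≤ η)
    (hη₁ : η ≤ 1) (hX : 0 < 1 - 2 * η * γ) (he₀ : 0 ≤ e) (he₁ : e ≤ 1) :
    ∃ V ∈ unitaryGroup (Fin 2) ℂ,
      workRatio γ η * e * (1 - (2 + workRatio γ η / (1 - 2 * η * γ)) * e)
        ≤ (gadc γ η (coherentState e) 1 1).re
          - ((V * gadc γ η (coherentState e) * Vᴴ) 1 1).re := by
  have hψ := isDensity_coherentState he₀ he₁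
  have ha := sub_nonneg.2 hγ₁
  set X := 1 - 2 * η * γ with hX_def
  -- The tangent of the angle that diagonalizes the output, to leading order in `e`.
  set t := √(1 - γ) * √e / X
  obtain ⟨V, hV, hwork⟩ :=
    exists_unitary_sub_re_conj_eq (isDensity_gadc hγ₀ hγ₁ hη₀ hη₁ hψ) t
  refine ⟨V, hV, ?_⟩
  have htX : √(1 - γ) * √e = t * X := (div_mul_cancel₀ _ hX.ne').symm
  have ht_sq : workRatio γ η * e = t ^ 2 * X := by
    rw [div_pow, mul_pow, Real.sq_sqrt ha, Real.sq_sqrt he₀, workRatio, ← hX_def]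
    field_simp
  have hratio : workRatio γ η / X * e = t ^ 2 := by
    rw [div_mul_eq_mul_div, ht_sq, mul_div_cancel_right₀ _ hX.ne']
  have hcoh : (gadc γ η (coherentState e) 0 1).re = √(1 - e) * (t * X) := by
    rw [← htX, mul_left_comm, ← re_coherentState_apply_zero_one]
    simp [gadc]
  have hsqrt : 1 - e ≤ √(1 - e) := Real.le_sqrt_of_sq_le (by nlinarith)
  rw [hwork, hcoh, re_gadc_apply_one_one γ η hψ.2, coherentState_apply_one_one he₀,
    Complex.ofReal_re, le_div_iff₀ (by positivity)]
  calc workRatio γ η * e * (1 - (2 + workRatio γ η / X) * e) * (1 + t ^ 2)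
      = t ^ 2 * X * (1 - 2 * e - t ^ 2 * (2 * e + t ^ 2)) := by
        rw [ht_sq, add_mul, hratio]
        ring
    _ ≤ t ^ 2 * X * (1 - 2 * e) :=
        mul_le_mul_of_nonneg_left (sub_le_self _ (by positivity)) (by positivity)
    _ ≤ t ^ 2 * X * (2 * √(1 - e) - 1) :=
        mul_le_mul_of_nonneg_left (by linarith) (by positivity)
    _ ≤ t ^ 2 * X * (2 * √(1 - e) - 1) + t ^ 2 * (2 * ((1 - γ) * e)) :=
        le_add_of_nonneg_right (by positivity)
    _ = t ^ 2 * (2 * (γ * η + (1 - γ) * e) - 1) + 2 * t * (√(1 - e) * (t * X)) := by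
        rw [hX_def]
        ring

/-- The constant in the `O(E / n)` deviation of the work/energy ratio of the coherent inputs from
`workRatio`. -/
noncomputable def errorConst (γ η : ℝ) : ℝ :=
  workRatio γ η * (2 + workRatio γ η / (1 - 2 * η * γ))

theorem errorConst_nonneg (hγ₁ : γ ≤ 1) (hX : 0 < 1 - 2 * η * γ) : 0 ≤ errorConst γ η := by
  have hc := workRatio_nonneg hγ₁ hX
  unfold errorConst
  positivity

variable {n : ℕ} {E : ℝ}

theorem le_localErgotropy_coherentInput (hγ₀ : 0 ≤ γ) (hγ₁ : γ ≤ 1) (hη₀ : 0 ≤ η)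
    (hη₁ : η ≤ 1) (hX : 0 < 1 - 2 * η * γ) (hE : 0 < E) (hn : E ≤ n) :
    workRatio γ η - errorConst γ η * (E / n)
      ≤ localErgotropy (channelPower (gadc γ η) n (coherentInput n E)) / E := by
  have hn₀ : (0 : ℝ) < n := hE.trans_le hn
  have he₀ : 0 ≤ E / n := by positivity
  have he₁ := (div_le_one hn₀).2 hn
  obtain ⟨V, hV, hwork⟩ := exists_unitary_coherentState_work_ge hγ₀ hγ₁ hη₀ hη₁ hX he₀ he₁
  have hout := isDensity_gadc hγ₀ hγ₁ hη₀ hη₁ (isDensity_coherentState he₀ he₁)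
  have hlocal := le_extractableWork (localUnitaries_subset n)
    (channelPower (gadc γ η) n (coherentInput n E)) ⟨fun _ => V, fun _ => hV, rfl⟩
  rw [coherentInput, channelPower_tensor, conjTranspose_tensor, tensor_mul, tensor_mul,
    energy_tensor fun _ => hout.2, energy_tensor fun _ => (hout.unitary_conj hV).2,
    ← Finset.sum_sub_distrib, Finset.sum_const, Finset.card_univ, Fintype.card_fin,
    nsmul_eq_mul] at hlocal
  rw [le_div_iff₀ hE, coherentInput, channelPower_tensor]
  calc (workRatio γ η - errorConst γ η * (E / n)) * E
      = n * (workRatio γ η * (E / n)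
          * (1 - (2 + workRatio γ η / (1 - 2 * η * γ)) * (E / n))) := by
        rw [errorConst]
        field_simp
    _ ≤ _ := mul_le_mul_of_nonneg_left hwork hn₀.le
    _ ≤ _ := hlocal

end CoherentInputs

section Mawer

theorem mawer_eq_of_le_of_tendsto {S : (n : ℕ) → ℝ → Set (CellsOp n)}
    {W : (n : ℕ) → CellsOp n → ℝ} {Λ : QubitOp →ₗ[ℂ] QubitOp} {c : ℝ}
    {ρ : (n : ℕ) → ℝ → CellsOp n}
    (hle : ∀ n E, ∀ σ ∈ S n E, W n (channelPower Λ n σ) ≤ c * E)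
    (hρ : ∀ E : ℝ, 0 < E → ∀ n : ℕ, E ≤ n → ρ n E ∈ S n E)
    (hlim : ∀ E : ℝ, 0 < E →
      Tendsto (fun n => W n (channelPower Λ n (ρ n E)) / E) atTop (𝓝 c)) :
    mawer S W Λ = (c : EReal) := by
  refine (limsup_congr ?_).trans (limsup_const (c : EReal))
  filter_upwards [eventually_gt_atTop 0] with E hE
  have hE' : (0 : EReal) < (E : EReal) := EReal.coe_pos.2 hE
  refine le_antisymm (iSup₂_le fun n _ => ?_) ?_
  · rw [EReal.div_le_iff_le_mul hE' (EReal.coe_ne_top E), ← EReal.coe_mul, mul_comm]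
    exact iSup₂_le fun σ hσ => EReal.coe_le_coe (hle n E σ hσ)
  · refine le_of_tendsto ((continuous_coe_real_ereal.tendsto c).comp (hlim E hE)) ?_
    filter_upwards [eventually_ge_atTop ⌈E⌉₊] with n hn
    rw [Function.comp_apply, EReal.coe_div]
    refine le_iSup₂_of_le n hn (EReal.div_le_div_right_of_nonneg hE'.le ?_)
    exact le_iSup₂ (f := fun σ (_ : σ ∈ S n E) => ((W n (channelPower Λ n σ) : ℝ) : EReal))
      (ρ n E) (hρ E hE n (Nat.ceil_le.1 hn))

theorem tendsto_of_abs_sub_le_mul_div {f : ℕ → ℝ} {c C E : ℝ}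
    (h : ∀ n : ℕ, E ≤ n → |f n - c| ≤ C * (E / n)) : Tendsto f atTop (𝓝 c) := by
  refine tendsto_iff_dist_tendsto_zero.2 (squeeze_zero' (.of_forall fun _ => dist_nonneg) ?_
    (by simpa using (tendsto_const_div_atTop_nhds_zero_nat E).const_mul C))
  filter_upwards [eventually_ge_atTop ⌈E⌉₊] with n hn
  exact h n (Nat.ceil_le.1 hn)

variable {γ η : ℝ} {n : ℕ} {E : ℝ}

theorem ergotropy_channelPower_gadc_le_of_mem_separableStates (hγ₀ : 0 ≤ γ) (hγ₁ : γ ≤ 1)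
    (hη₀ : 0 ≤ η) (hη₁ : η ≤ 1) (hX : 0 < 1 - 2 * η * γ) {ρ : CellsOp n}
    (hρ : ρ ∈ separableStates n E) :
    ergotropy (channelPower (gadc γ η) n ρ) ≤ workRatio γ η * E :=
  (ergotropy_channelPower_gadc_le_of_isSeparable hγ₀ hγ₁ hη₀ hη₁ hX hρ.1.1 hρ.2).trans
    (mul_le_mul_of_nonneg_left hρ.1.2 (workRatio_nonneg hγ₁ hX))

theorem abs_ergotropy_coherentInput_sub_le (hγ₀ : 0 ≤ γ) (hγ₁ : γ ≤ 1) (hη₀ : 0 ≤ η)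
    (hη₁ : η ≤ 1) (hX : 0 < 1 - 2 * η * γ) (hE : 0 < E) (hn : E ≤ n) :
    |ergotropy (channelPower (gadc γ η) n (coherentInput n E)) / E - workRatio γ η|
        ≤ errorConst γ η * (E / n) ∧
      |localErgotropy (channelPower (gadc γ η) n (coherentInput n E)) / E - workRatio γ η|
        ≤ errorConst γ η * (E / n) := by
  have hupper : ergotropy (channelPower (gadc γ η) n (coherentInput n E)) / E ≤ workRatio γ η :=
    (div_le_iff₀ hE).2 (ergotropy_channelPower_gadc_le_of_mem_separableStates hγ₀ hγ₁ hη₀ hη₁ hX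
      (coherentInput_mem_separableStates hE hn))
  have hlower := le_localErgotropy_coherentInput hγ₀ hγ₁ hη₀ hη₁ hX hE hn
  have hlocal := div_le_div_of_nonneg_right
    (localErgotropy_le_ergotropy (channelPower (gadc γ η) n (coherentInput n E))) hE.le
  have herr := mul_nonneg (errorConst_nonneg hγ₁ hX) (div_nonneg hE.le n.cast_nonneg)
  constructor <;> refine abs_le.2 ⟨?_, ?_⟩ <;> linarith

theorem tendsto_ergotropy_coherentInput (hγ₀ : 0 ≤ γ) (hγ₁ : γ ≤ 1) (hη₀ : 0 ≤ η)
    (hη₁ : η ≤ 1) (hX : 0 < 1 - 2 * η * γ) (hE : 0 < E) :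
    Tendsto (fun n : ℕ => ergotropy (channelPower (gadc γ η) n (coherentInput n E)) / E) atTop
      (𝓝 (workRatio γ η)) :=
  tendsto_of_abs_sub_le_mul_div fun _ hn =>
    (abs_ergotropy_coherentInput_sub_le hγ₀ hγ₁ hη₀ hη₁ hX hE hn).1

theorem tendsto_localErgotropy_coherentInput (hγ₀ : 0 ≤ γ) (hγ₁ : γ ≤ 1) (hη₀ : 0 ≤ η)
    (hη₁ : η ≤ 1) (hX : 0 < 1 - 2 * η * γ) (hE : 0 < E) :
    Tendsto (fun n : ℕ => localErgotropy (channelPower (gadc γ η) n (coherentInput n E)) / E)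
      atTop (𝓝 (workRatio γ η)) :=
  tendsto_of_abs_sub_le_mul_div fun _ hn =>
    (abs_ergotropy_coherentInput_sub_le hγ₀ hγ₁ hη₀ hη₁ hX hE hn).2

theorem sepMawer_gadc (hγ₀ : 0 ≤ γ) (hγ₁ : γ ≤ 1) (hη₀ : 0 ≤ η) (hη₁ : η ≤ 1)
    (hX : 0 < 1 - 2 * η * γ) : sepMawer (gadc γ η) = (workRatio γ η : EReal) :=
  mawer_eq_of_le_of_tendsto
    (fun _ _ _ => ergotropy_channelPower_gadc_le_of_mem_separableStates hγ₀ hγ₁ hη₀ hη₁ hX)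
    (fun _ hE _ => coherentInput_mem_separableStates hE)
    fun _ => tendsto_ergotropy_coherentInput hγ₀ hγ₁ hη₀ hη₁ hX

theorem locMawer_gadc (hγ₀ : 0 ≤ γ) (hγ₁ : γ ≤ 1) (hη₀ : 0 ≤ η) (hη₁ : η ≤ 1)
    (hX : 0 < 1 - 2 * η * γ) : locMawer (gadc γ η) = (workRatio γ η : EReal) :=
  mawer_eq_of_le_of_tendsto
    (fun _ _ _ hρ => (localErgotropy_channelPower_gadc_le hγ₀ hγ₁ hη₀ hη₁ hX hρ.1).trans
      (mul_le_mul_of_nonneg_left hρ.2 (workRatio_nonneg hγ₁ hX)))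
    (fun _ hE _ hn => (coherentInput_mem_separableStates hE hn).1)
    fun _ => tendsto_localErgotropy_coherentInput hγ₀ hγ₁ hη₀ hη₁ hX

theorem locSepMawer_gadc (hγ₀ : 0 ≤ γ) (hγ₁ : γ ≤ 1) (hη₀ : 0 ≤ η) (hη₁ : η ≤ 1)
    (hX : 0 < 1 - 2 * η * γ) : locSepMawer (gadc γ η) = (workRatio γ η : EReal) :=
  mawer_eq_of_le_of_tendsto
    (fun _ _ _ hρ => (localErgotropy_le_ergotropy _).trans
      (ergotropy_channelPower_gadc_le_of_mem_separableStates hγ₀ hγ₁ hη₀ hη₁ hX hρ))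
    (fun _ hE _ => coherentInput_mem_separableStates hE)
    fun _ => tendsto_localErgotropy_coherentInput hγ₀ hγ₁ hη₀ hη₁ hX

theorem ergotropicMawer_adc (hγ₀ : 0 ≤ γ) (hγ₁ : γ ≤ 1) :
    ergotropicMawer (adc γ) = ((1 - γ : ℝ) : EReal) := by
  refine mawer_eq_of_le_of_tendsto
    (fun _ _ _ hρ => (ergotropy_channelPower_adc_le hγ₀ hγ₁ hρ.1.1).trans
      (mul_le_mul_of_nonneg_left hρ.2 (sub_nonneg.2 hγ₁)))
    (fun _ hE _ hn => (coherentInput_mem_separableStates hE hn).1) fun E hE => ?_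
  have h := tendsto_ergotropy_coherentInput (η := 0) hγ₀ hγ₁ le_rfl zero_le_one (by norm_num) hE
  rwa [gadc_eq_adc (mul_zero γ), workRatio, mul_zero, zero_mul, sub_zero, div_one] at h

theorem one_sub_lt_workRatio (hγ₀ : 0 < γ) (hγ₁ : γ < 1) (hη : 0 < η)
    (hX : 0 < 1 - 2 * η * γ) : 1 - γ < workRatio γ η := by
  rw [workRatio, lt_div_iff₀ hX]
  exact mul_lt_of_lt_one_right (sub_pos.2 hγ₁) (by linarith [mul_pos hη hγ₀])

theorem workRatio_half (hγ : γ ≠ 1) : workRatio γ (1 / 2) = 1 := by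
  rw [workRatio, mul_one_div_cancel two_ne_zero, one_mul, div_self (sub_ne_zero.2 hγ.symm)]

end Mawer

end QuantumBattery

theorem mainTheorem6_general (γ η : ℝ) (hγ₀ : 0 ≤ γ) (hγ₁ : γ ≤ 1) (hη₀ : 0 ≤ η) (hη₁ : η ≤ 1)
    (hX : 0 < 1 - 2 * η * γ) :
    (sepMawer (gadc γ η) = (((1 - γ) / (1 - 2 * η * γ) : ℝ) : EReal) ∧
      locMawer (gadc γ η) = (((1 - γ) / (1 - 2 * η * γ) : ℝ) : EReal) ∧
      locSepMawer (gadc γ η) = (((1 - γ) / (1 - 2 * η * γ) : ℝ) : EReal)) ∧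
    (∀ (E : ℝ) (n : ℕ), 0 < E → E ≤ n →
      coherentInput n E ∈ separableStates n E ∧ energy (coherentInput n E) = E) ∧
    (∀ E : ℝ, 0 < E →
      Tendsto (fun n : ℕ => ergotropy (channelPower (gadc γ η) n (coherentInput n E)) / E)
        atTop (𝓝 ((1 - γ) / (1 - 2 * η * γ))) ∧
      Tendsto (fun n : ℕ => localErgotropy (channelPower (gadc γ η) n (coherentInput n E)) / E)
        atTop (𝓝 ((1 - γ) / (1 - 2 * η * γ)))) ∧
    (∃ C : ℝ, ∀ (E : ℝ) (n : ℕ), 0 < E → E ≤ n →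
      |ergotropy (channelPower (gadc γ η) n (coherentInput n E)) / E
          - (1 - γ) / (1 - 2 * η * γ)| ≤ C * (E / n) ∧
      |localErgotropy (channelPower (gadc γ η) n (coherentInput n E)) / E
          - (1 - γ) / (1 - 2 * η * γ)| ≤ C * (E / n)) ∧
    ergotropicMawer (adc γ) = ((1 - γ : ℝ) : EReal) ∧
    (0 < η → 0 < γ → γ < 1 →
      ergotropicMawer (adc γ) < sepMawer (gadc γ η) ∧
      ergotropicMawer (adc γ) < locMawer (gadc γ η) ∧
      ergotropicMawer (adc γ) < locSepMawer (gadc γ η)) ∧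
    (η = 1 / 2 →
      sepMawer (gadc γ η) = 1 ∧ locMawer (gadc γ η) = 1 ∧ locSepMawer (gadc γ η) = 1) := by
  have hsep := sepMawer_gadc hγ₀ hγ₁ hη₀ hη₁ hX
  have hloc := locMawer_gadc hγ₀ hγ₁ hη₀ hη₁ hX
  have hlocSep := locSepMawer_gadc hγ₀ hγ₁ hη₀ hη₁ hX
  have hadc := ergotropicMawer_adc hγ₀ hγ₁
  refine ⟨⟨hsep, hloc, hlocSep⟩,
    fun E n hE hn => ⟨coherentInput_mem_separableStates hE hn, energy_coherentInput hE hn⟩,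
    fun E hE => ⟨tendsto_ergotropy_coherentInput hγ₀ hγ₁ hη₀ hη₁ hX hE,
      tendsto_localErgotropy_coherentInput hγ₀ hγ₁ hη₀ hη₁ hX hE⟩,
    ⟨errorConst γ η,
      fun E n hE hn => abs_ergotropy_coherentInput_sub_le hγ₀ hγ₁ hη₀ hη₁ hX hE hn⟩,
    hadc, fun hη hγ hγ' => ?_, ?_⟩
  · have hlt := EReal.coe_lt_coe (one_sub_lt_workRatio hγ hγ' hη hX)
    rw [hadc, hsep, hloc, hlocSep]
    exact ⟨hlt, hlt, hlt⟩
  · rintro rfl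
    rw [hsep, hloc, hlocSep, workRatio_half (by rintro rfl; norm_num at hX), EReal.coe_one]
    exact ⟨rfl, rfl, rfl⟩

theorem mainTheorem6 (γ η : ℝ) (hγ₀ : 0 ≤ γ) (hγ₁ : γ ≤ 1) (hη₀ : 0 ≤ η) (hη₁ : η ≤ 1 / 2)
    (hne : 1 - 2 * η * γ ≠ 0) :
    -- the three restricted MAWERs of the GADC
    (sepMawer (gadc γ η) = (((1 - γ) / (1 - 2 * η * γ) : ℝ) : EReal) ∧
      locMawer (gadc γ η) = (((1 - γ) / (1 - 2 * η * γ) : ℝ) : EReal) ∧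
      locSepMawer (gadc γ η) = (((1 - γ) / (1 - 2 * η * γ) : ℝ) : EReal)) ∧
    -- the coherent product inputs are admissible, with energy exactly `E`
    (∀ (E : ℝ) (n : ℕ), 0 < E → E ≤ n →
      coherentInput n E ∈ separableStates n E ∧ energy (coherentInput n E) = E) ∧
    -- they attain the value as `n → ∞`, with global and with local operations
    (∀ E : ℝ, 0 < E →
      Tendsto (fun n : ℕ => ergotropy (channelPower (gadc γ η) n (coherentInput n E)) / E)
        atTop (𝓝 ((1 - γ) / (1 - 2 * η * γ))) ∧
      Tendsto (fun n : ℕ => localErgotropy (channelPower (gadc γ η) n (coherentInput n E)) / E)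
        atTop (𝓝 ((1 - γ) / (1 - 2 * η * γ)))) ∧
    -- and the error is `O(E / n)`
    (∃ C : ℝ, ∀ (E : ℝ) (n : ℕ), 0 < E → E ≤ n →
      |ergotropy (channelPower (gadc γ η) n (coherentInput n E)) / E
          - (1 - γ) / (1 - 2 * η * γ)| ≤ C * (E / n) ∧
      |localErgotropy (channelPower (gadc γ η) n (coherentInput n E)) / E
          - (1 - γ) / (1 - 2 * η * γ)| ≤ C * (E / n)) ∧
    -- comparison with the unrestricted MAWER of the ADC
    ergotropicMawer (adc γ) = ((1 - γ : ℝ) : EReal) ∧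
    (0 < η → 0 < γ → γ < 1 →
      ergotropicMawer (adc γ) < sepMawer (gadc γ η) ∧
      ergotropicMawer (adc γ) < locMawer (gadc γ η) ∧
      ergotropicMawer (adc γ) < locSepMawer (gadc γ η)) ∧
    -- the infinite-temperature case
    (η = 1 / 2 →
      sepMawer (gadc γ η) = 1 ∧ locMawer (gadc γ η) = 1 ∧ locSepMawer (gadc γ η) = 1) :=
  mainTheorem6_general γ η hγ₀ hγ₁ hη₀ (by linarith) (lt_of_le_of_ne (by nlinarith) hne.symm)
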